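/- Let $\Sigma$ be a finite family of nondegenerate simplices of $\mathbb{R}^d$, write $d_\sigma$ for the dimension of $\sigma\in\Sigma$, and let $K=\bigcup_{\sigma\in\Sigma}\sigma$. Let $\mu$ be a regular simplicial measure over $\Sigma$, that is, $\mu(B)=\sum_{\sigma\in\Sigma}\int_{B\cap\sigma}\rho_\sigma\,\mathrm{d}\mathcal{H}^{d_\sigma}$ for every Borel set $B$, where $d_\sigma\ge 2$ and $\rho_\sigma:\sigma\to\mathbb{R}$ is continuous with $\min_\sigma\rho_\sigma>0$ for every $\sigma\in\Sigma$, and where $K\setminus S$ is connected for every finite set $S\subseteq K$. Let $y_1,\dots,y_N\in\mathbb{R}^d$ be in generic position with respect to $\Sigma$: for every $k$-dimensional simplex $\sigma\in\Sigma$ with vertices $x_0,\dots,x_k$, every $p\in\{1,\dots,k\}$, every $\ell\in\{1,\dots,\min(d,N-1)\}$, all distinct $i_0,\dots,i_\ell\in\{1,\dots,N\}$ and all distinct $j_0,\dots,j_p\in\{0,\dots,k\}$, $$\dim\big(\{y_{i_1}-y_{i_0},\dots,y_{i_\ell}-y_{i_0}\}^\perp\cap\mathrm{span}(x_{j_1}-x_{j_0},\dots,x_{j_p}-x_{j_0})\big)=\max(p-\ell,0).$$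 For $\psi\in\mathbb{R}^N$ let $\mathrm{Lag}_i(\psi)=\{x\in K\mid \forall j,\ \|x-y_i\|^2+\psi_i\le\|x-y_j\|^2+\psi_j\}$, let $G:\mathbb{R}^N\to\mathbb{R}^N$ be given by $G_i(\psi)=\mu(\mathrm{Lag}_i(\psi))$, and let $\mathcal{K}^+=\{\psi\in\mathbb{R}^N\mid \forall i,\ G_i(\psi)>0\}$. Then for every $\psi\in\mathcal{K}^+$ the map $G$ is differentiable at $\psi$, and for every nonzero $v\in\mathbb{R}^N$ with $\sum_{i=1}^N v_i=0$, $$\langle DG(\psi)v,v\rangle<0.$$ -/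

import Mathlib

open MeasureTheory

/-- A simplex soup: a finite family of (nondegenerate) simplices of `ℝ^d`, of arbitrary
dimensions; each member is stored together with its dimension. -/
structure SimplexSoup (d : ℕ) where
  card : ℕ
  simplex : Fin card → Σ k : ℕ, Affine.Simplex ℝ (EuclideanSpace ℝ (Fin d)) k

namespace SimplexSoup

variable {d : ℕ}

/-- The dimension `d_σ` of the simplex of index `s`. -/
def dim (T : SimplexSoup d) (s : Fin T.card) : ℕ := (T.simplex s).1

/-- The simplex of index `s`, as a subset of `ℝ^d`: the convex hull of its vertices. -/
def cell (T : SimplexSoup d) (s : Fin T.card) : Set (EuclideanSpace ℝ (Fin d)) :=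
  convexHull ℝ (Set.range (T.simplex s).2.points)

/-- The support `K = ⋃ σ` of the soup. -/
def support (T : SimplexSoup d) : Set (EuclideanSpace ℝ (Fin d)) := ⋃ s, T.cell s

/-- The measure `B ↦ ∑_σ ∫_{B ∩ σ} ρ_σ dℋ^{d_σ}`. The Hausdorff measure is normalized so that it
is the usual `d_σ`-dimensional volume. Only the values of `ρ s` on the simplex `s` matter. -/
noncomputable def simplicialMeasure (T : SimplexSoup d)
    (ρ : Fin T.card → EuclideanSpace ℝ (Fin d) → ℝ) : Measure (EuclideanSpace ℝ (Fin d)) :=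
  ∑ s, ((Measure.euclideanHausdorffMeasure (T.dim s)).restrict (T.cell s)).withDensity
    (fun x => ENNReal.ofReal (ρ s x))

/-- `μ` is a regular simplicial measure over the soup: the simplices have dimension at least 2,
the densities are continuous and positive on their (compact) simplices, and the support stays
connected when finitely many points are removed. -/
def IsRegularSimplicialMeasure (T : SimplexSoup d)
    (μ : Measure (EuclideanSpace ℝ (Fin d))) : Prop :=
  (∃ ρ : Fin T.card → EuclideanSpace ℝ (Fin d) → ℝ,
      μ = T.simplicialMeasure ρ ∧
      ∀ s, ContinuousOn (ρ s) (T.cell s) ∧ ∀ x ∈ T.cell s, 0 < ρ s x) ∧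
    (∀ s, 2 ≤ T.dim s) ∧
    ∀ S : Set (EuclideanSpace ℝ (Fin d)), S ⊆ T.support → S.Finite →
      IsConnected (T.support \ S)

/-- Generic position of `y_1, …, y_N` with respect to a `k`-dimensional simplex. The subtraction
`p - ℓ` is the truncated one, that is `max (p - ℓ) 0`. -/
def IsGenericForSimplex {N k : ℕ} (y : Fin N → EuclideanSpace ℝ (Fin d))
    (σ : Affine.Simplex ℝ (EuclideanSpace ℝ (Fin d)) k) : Prop :=
  ∀ p : ℕ, 1 ≤ p → p ≤ k → ∀ l : ℕ, 1 ≤ l → l ≤ min d (N - 1) →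
    ∀ i : Fin (l + 1) → Fin N, Function.Injective i →
    ∀ j : Fin (p + 1) → Fin (k + 1), Function.Injective j →
      Module.finrank ℝ
        ↥((Submodule.span ℝ (Set.range fun a : Fin l => y (i a.succ) - y (i 0)))ᗮ ⊓
          Submodule.span ℝ
            (Set.range fun b : Fin p => σ.points (j b.succ) - σ.points (j 0))) = p - l

/-- Generic position with respect to every simplex of the soup. -/
def IsGeneric {N : ℕ} (T : SimplexSoup d) (y : Fin N → EuclideanSpace ℝ (Fin d)) : Prop :=
  ∀ s, IsGenericForSimplex y (T.simplex s).2

end SimplexSoup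

/-- The power cell `Pow_i(ψ) = {x | ∀ j, ‖x - y_i‖² + ψ_i ≤ ‖x - y_j‖² + ψ_j}`. -/
def powerCell {d N : ℕ} (y : Fin N → EuclideanSpace ℝ (Fin d))
    (ψ : EuclideanSpace ℝ (Fin N)) (i : Fin N) : Set (EuclideanSpace ℝ (Fin d)) :=
  {x | ∀ j, ‖x - y i‖ ^ 2 + ψ i ≤ ‖x - y j‖ ^ 2 + ψ j}

/-- The Laguerre cell `Lag_i(ψ) = Pow_i(ψ) ∩ K`. -/
def laguerreCell {d N : ℕ} (T : SimplexSoup d) (y : Fin N → EuclideanSpace ℝ (Fin d))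
    (ψ : EuclideanSpace ℝ (Fin N)) (i : Fin N) : Set (EuclideanSpace ℝ (Fin d)) :=
  powerCell y ψ i ∩ T.support

/-- The map `G : ℝ^N → ℝ^N`, `G_i(ψ) = μ(Lag_i(ψ))`. -/
noncomputable def massMap {d N : ℕ} (T : SimplexSoup d)
    (μ : Measure (EuclideanSpace ℝ (Fin d))) (y : Fin N → EuclideanSpace ℝ (Fin d))
    (ψ : EuclideanSpace ℝ (Fin N)) : EuclideanSpace ℝ (Fin N) :=
  WithLp.toLp 2 fun i => μ.real (laguerreCell T y ψ i)

/-- The set `𝒦⁺` of weights for which every Laguerre cell has positive mass. -/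
def positiveMassSet {d N : ℕ} (T : SimplexSoup d)
    (μ : Measure (EuclideanSpace ℝ (Fin d))) (y : Fin N → EuclideanSpace ℝ (Fin d)) :
    Set (EuclideanSpace ℝ (Fin N)) :=
  {ψ | ∀ i, 0 < massMap T μ y ψ i}

/-! On a fixed simplex the functions `‖x - y i‖ ^ 2` differ from one another by affine functions, so
a Laguerre cell cuts the simplex along half-spaces whose thresholds are the differences `ψ j - ψ i`
up to constants. By Fubini, the partial derivative of the mass of such a polyhedron with respect to
one threshold is, up to a positive normalization, the integral of the density over the corresponding
facet. Genericity makes the hyperplanes transverse to one another and to the facets of the simplex,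
so these facet integrals are continuous and the mass is differentiable
(`hasFDerivAt_setIntegral_polyhedron`, `exists_hasFDerivAt_setIntegral_affineCell`). Summing over
simplices gives `DG_i(ψ) v = ∑ j, H i j * (v j - v i)` with `H ≥ 0`.

Symmetry of `H` is not needed. The cells overlap in null sets, so the total mass is constant and `∑
i, ∑ j, H i j * (w j - w i) = 0` for every `w`. Taking `w = v ^ 2` turns the quadratic form into
`-(1/2) ∑ H i j * (v i - v j) ^ 2` (`two_mul_sum_mul_sub_eq`).

For strictness, `H i j > 0` as soon as cells `i` and `j` share a point outside a finite set `S`: by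
genericity, such a point can be moved into the interior of a simplex so that only `i` and `j` remain
minimal (`exists_interior_point_two_minimizers`). If `v` is nonzero with zero sum, the cells where
`v` is maximal and the others form two closed families covering `K`. Since `K \ S` is connected,
they meet outside `S` (`exists_mem_interface`), which gives a positive term in the sum. -/

/-! ### Differentiability from continuous partial derivatives -/

open Filter Topology Set in
/-- A function with continuous partial derivatives is differentiable. -/
theorem hasFDerivAt_pi_of_continuousAt_partial {ι : Type*} [Fintype ι] [DecidableEq ι]
    {f : (ι → ℝ) → ℝ} {g : ι → (ι → ℝ) → ℝ} {t₀ : ι → ℝ}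
    (hg : ∀ j, ContinuousAt (g j) t₀)
    (hf : ∀ j t, HasDerivAt (fun s => f (Function.update t j s)) (g j t) (t j)) :
    HasFDerivAt f (∑ j, g j t₀ • ContinuousLinearMap.proj (R := ℝ) (φ := fun _ : ι => ℝ) j) t₀ := by
  -- Coordinates are moved from `t₀` to `t` one at a time; `s` is the set of coordinates already
  -- moved.
  have key : ∀ s : Finset ι, (fun t => f (s.piecewise t t₀) - f t₀ -
      ∑ j ∈ s, g j t₀ * (t j - t₀ j)) =o[𝓝 t₀] fun t => t - t₀ := by
    intro s
    induction s using Finset.induction_on with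
    | empty => simp
    | insert a s ha ih =>
      have h2 : (fun t => f ((insert a s).piecewise t t₀) - f (s.piecewise t t₀) -
          g a t₀ * (t a - t₀ a)) =o[𝓝 t₀] fun t => t - t₀ := by
        rw [Asymptotics.isLittleO_iff]
        intro ε hε
        obtain ⟨δ, hδ, hball⟩ := Metric.continuousAt_iff.1 (hg a) ε hε
        filter_upwards [Metric.ball_mem_nhds t₀ hδ] with t ht
        set r := s.piecewise t t₀ with hr
        have hra : r a = t₀ a := by simp [hr, ha]
        have hmem : ∀ c ∈ uIcc (t₀ a) (t a), ‖g a (Function.update r a c) - g a t₀‖ ≤ ε := by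
          intro c hc
          rw [← dist_eq_norm]
          refine (hball ?_).le
          refine lt_of_le_of_lt ?_ (Metric.mem_ball.1 ht)
          refine (dist_pi_le_iff dist_nonneg).2 fun i => ?_
          by_cases hi : i = a
          · subst hi
            simp only [Function.update_self]
            refine le_trans ?_ (dist_le_pi_dist t t₀ i)
            rw [Real.dist_eq, Real.dist_eq]
            exact abs_sub_left_of_mem_uIcc hc
          · rw [Function.update_of_ne hi, hr]
            by_cases his : i ∈ s
            · simpa [his] using dist_le_pi_dist t t₀ i
            · simp [his]
        -- Subtracting the linear term leaves a derivative of size at most `ε` along the segment, so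
        -- the mean value inequality gives the little-o bound.
        have hder : ∀ c ∈ uIcc (t₀ a) (t a), HasDerivWithinAt
            (fun c => f (Function.update r a c) - g a t₀ * c)
            (g a (Function.update r a c) - g a t₀) (uIcc (t₀ a) (t a)) c := by
          intro c _
          have := hf a (Function.update r a c)
          simp only [Function.update_idem, Function.update_self] at this
          exact (this.sub (by simpa using (hasDerivAt_id c).const_mul (g a t₀))).hasDerivWithinAt
        have := Convex.norm_image_sub_le_of_norm_hasDerivWithin_le hder hmem (convex_uIcc _ _)
          left_mem_uIcc right_mem_uIcc
        rw [Finset.piecewise_insert, ← hr]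
        have hself : Function.update r a (t₀ a) = r := by rw [← hra, Function.update_eq_self]
        rw [hself] at this
        calc _ = ‖f (Function.update r a (t a)) - g a t₀ * t a - (f r - g a t₀ * t₀ a)‖ := by
              congr 1; ring
          _ ≤ ε * ‖t a - t₀ a‖ := this
          _ ≤ ε * ‖t - t₀‖ := by
              gcongr
              exact norm_le_pi_norm (t - t₀) a
      refine (h2.add ih).congr_left fun t => ?_
      rw [Finset.sum_insert ha]
      ring
  rw [hasFDerivAt_iff_isLittleO]
  refine (key Finset.univ).congr_left fun t => ?_
  simp

/-! ### Slicing Haar measure by a linear form -/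

section Slice

variable {E : Type*} [NormedAddCommGroup E] [NormedSpace ℝ E] [FiniteDimensional ℝ E]
  [MeasurableSpace E] [BorelSpace E]

/-- Fubini along the slices of a linear form, up to the normalization of the Haar measure. -/
theorem exists_smul_map_slice (μ : Measure E) [μ.IsAddHaarMeasure] (lam : E →L[ℝ] ℝ) {e : E}
    (he : lam e = 1) (ν : Measure lam.ker) [ν.IsAddHaarMeasure] :
    ∃ c : NNReal, c ≠ 0 ∧
      μ = c • ((volume : Measure ℝ).prod ν).map (fun p : ℝ × lam.ker => p.1 • e + (p.2 : E)) ∧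
      MeasurableEmbedding (fun p : ℝ × lam.ker => p.1 • e + (p.2 : E)) := by
  let L₀ : (ℝ × lam.ker) ≃ₗ[ℝ] E :=
    { toFun := fun p => p.1 • e + (p.2 : E)
      map_add' := by intro p q; simp [add_smul]; abel
      map_smul' := by intro r p; simp [mul_smul]
      invFun := fun x => (lam x, ⟨x - lam x • e, by simp [he]⟩)
      left_inv := by
        rintro ⟨s, z, hz⟩
        have hz' : lam z = 0 := hz
        ext <;> simp [he, hz']
      right_inv := by intro x; simp }
  let L : (ℝ × lam.ker) ≃L[ℝ] E := L₀.toContinuousLinearEquiv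
  have hL : (fun p : ℝ × lam.ker => p.1 • e + (p.2 : E)) = L := rfl
  rw [hL]
  have hh : (((volume : Measure ℝ).prod ν).map L).IsAddHaarMeasure :=
    L.isAddHaarMeasure_map _
  refine ⟨Measure.addHaarScalarFactor μ (((volume : Measure ℝ).prod ν).map L),
    (Measure.addHaarScalarFactor_pos_of_isAddHaarMeasure _ _).ne',
    Measure.isAddLeftInvariant_eq_smul _ _, L.toHomeomorph.measurableEmbedding⟩

/-- The zero set of a nonconstant affine function on a finite-dimensional space is null. -/
theorem ae_add_ne_of_linear_ne_zero {W : Type*} [NormedAddCommGroup W] [NormedSpace ℝ W]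
    [FiniteDimensional ℝ W] [MeasurableSpace W] [BorelSpace W] (ν : Measure W)
    [ν.IsAddHaarMeasure] (f : W →ₗ[ℝ] ℝ) {w : W} (hw : f w ≠ 0) (a b : ℝ) :
    ∀ᵐ z ∂ν, a + f z ≠ b := by
  let A : AffineSubspace ℝ W :=
    (AffineSubspace.mk' (0 : ℝ) (⊥ : Submodule ℝ ℝ)).comap
      (f.toAffineMap + AffineMap.const ℝ W (a - b))
  have hA : ∀ z, z ∈ A ↔ a + f z = b := by
    intro z
    simp only [A, AffineSubspace.mem_comap, AffineSubspace.mem_mk']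
    simp
    constructor <;> intro h <;> linarith
  have hne : A ≠ ⊤ := by
    intro htop
    have h0 := (hA 0).1 (htop ▸ AffineSubspace.mem_top ℝ W 0)
    have h1 := (hA w).1 (htop ▸ AffineSubspace.mem_top ℝ W w)
    simp at h0
    exact hw (by linarith)
  have := Measure.addHaar_affineSubspace ν A hne
  rw [ae_iff]
  convert this using 2
  ext z
  simp [hA]

end Slice

/-! ### Mass of a polyhedron as a function of its thresholds -/

section SliceMass

open Filter Topology Set

variable {E : Type*} [NormedAddCommGroup E] [NormedSpace ℝ E] [FiniteDimensional ℝ E]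
  [MeasurableSpace E] [BorelSpace E] {ι : Type*} [Fintype ι] [DecidableEq ι]

/-- The mass of the polyhedron `{x | ∀ l, lam l x ≤ t l}` on the slice `lam j = t j`, the
constraint `j` being dropped. -/
noncomputable def sliceMass (lam : ι → E →L[ℝ] ℝ) (ρ : E → ℝ) (e : ι → E) (j : ι)
    (t : ι → ℝ) : ℝ :=
  ∫ z : (lam j).ker, {x | ∀ l, l ≠ j → lam l x ≤ t l}.indicator ρ (t j • e j + (z : E))
    ∂Measure.addHaar

variable {lam : ι → E →L[ℝ] ℝ} {ρ : E → ℝ} {e : ι → E} {C R : ℝ}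

omit [Fintype ι] [DecidableEq ι] in
theorem sliceMass_nonneg (hρ : ∀ x, 0 ≤ ρ x) (j : ι) (t : ι → ℝ) :
    0 ≤ sliceMass lam ρ e j t :=
  integral_nonneg fun _ => indicator_nonneg (fun x _ => hρ x) _

omit [FiniteDimensional ℝ E] [DecidableEq ι] in
theorem measurableSet_forall_le (lam : ι → E →L[ℝ] ℝ) (p : ι → Prop) (t : ι → ℝ) :
    MeasurableSet {x | ∀ l, p l → lam l x ≤ t l} := by
  have : {x | ∀ l, p l → lam l x ≤ t l} = ⋂ l, ⋂ (_ : p l), {x | lam l x ≤ t l} := by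
    ext; simp
  rw [this]
  exact MeasurableSet.iInter fun l => MeasurableSet.iInter fun _ =>
    measurableSet_le (lam l).continuous.measurable measurable_const

/-- A bounded function with bounded support is dominated, on all slices of a linear form, by the
same integrable function. -/
theorem exists_integrable_bound_slice (hC : ∀ x, |ρ x| ≤ C) (hR : ∀ x, R < ‖x‖ → ρ x = 0)
    (l : E →L[ℝ] ℝ) {e : E} (he : l e = 1) :
    ∃ b : l.ker → ℝ, Integrable b Measure.addHaar ∧
      ∀ (A : Set E) (s : ℝ) (z : l.ker), ‖A.indicator ρ (s • e + (z : E))‖ ≤ b z := by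
  have hC0 : 0 ≤ C := (abs_nonneg _).trans (hC 0)
  -- The kernel component of `x` is `x - l x • e`, and this factor bounds the norm of that
  -- projection. The radius therefore does not depend on the slice.
  set R' := (1 + ‖l‖ * ‖e‖) * R
  refine ⟨(Metric.closedBall (0 : l.ker) R').indicator fun _ => C, ?_, ?_⟩
  · refine (integrable_indicator_iff Metric.isClosed_closedBall.measurableSet).2 ?_
    refine integrableOn_const ?_
    exact (isCompact_closedBall (0 : l.ker) R').measure_lt_top.ne
  · intro A s z
    by_cases hz : z ∈ Metric.closedBall (0 : l.ker) R'
    · rw [indicator_of_mem hz]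
      exact (norm_indicator_le_norm_self _ _).trans (hC _)
    · have h0 : ρ (s • e + (z : E)) = 0 := by
        apply hR
        by_contra hcon
        push Not at hcon
        apply hz
        have hlz : l (z : E) = 0 := z.2
        have hz' : (z : E) = (s • e + (z : E)) - l (s • e + (z : E)) • e := by simp [he, hlz]
        rw [mem_closedBall_zero_iff]
        change ‖(z : E)‖ ≤ R'
        rw [hz']
        set x := s • e + (z : E)
        calc ‖x - l x • e‖ ≤ ‖x‖ + ‖l x • e‖ := norm_sub_le _ _
          _ ≤ ‖x‖ + ‖l‖ * ‖x‖ * ‖e‖ := by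
            rw [norm_smul]
            gcongr
            exact l.le_opNorm x
          _ = (1 + ‖l‖ * ‖e‖) * ‖x‖ := by ring
          _ ≤ R' := by simp only [R']; gcongr
      rw [indicator_of_notMem hz]
      refine (norm_indicator_le_norm_self _ _).trans ?_
      rw [h0, norm_zero]

theorem integrable_of_bounded_of_support {μ : Measure E} [IsFiniteMeasureOnCompacts μ]
    (hm : Measurable ρ) (hC : ∀ x, |ρ x| ≤ C) (hR : ∀ x, R < ‖x‖ → ρ x = 0) :
    Integrable ρ μ := by
  have hsupp : ρ = (Metric.closedBall (0 : E) R).indicator ρ := by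
    ext x
    by_cases hx : x ∈ Metric.closedBall (0 : E) R
    · rw [indicator_of_mem hx]
    · rw [indicator_of_notMem hx]
      exact hR x (by simpa using hx)
  rw [hsupp, integrable_indicator_iff Metric.isClosed_closedBall.measurableSet]
  exact Measure.integrableOn_of_bounded (M := C)
    (isCompact_closedBall (0 : E) R).measure_lt_top.ne hm.aestronglyMeasurable
    (ae_of_all _ fun x => hC x)

/-- Dominated convergence: the other constraints are nonconstant on the slice, so almost every point
of it avoids their boundary hyperplanes as well as the discontinuities of `ρ`, and there the
integrand varies continuously with `t`. -/
theorem continuous_sliceMass (hm : Measurable ρ) (hC : ∀ x, |ρ x| ≤ C)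
    (hR : ∀ x, R < ‖x‖ → ρ x = 0) (j : ι) (he : lam j (e j) = 1)
    (hind : ∀ l, l ≠ j → ∃ w : (lam j).ker, lam l w ≠ 0)
    (hcont : ∀ s : ℝ, ∀ᵐ z : (lam j).ker ∂Measure.addHaar, ContinuousAt ρ (s • e j + (z : E))) :
    Continuous (sliceMass lam ρ e j) := by
  obtain ⟨b, hb, hbound⟩ := exists_integrable_bound_slice hC hR (lam j) he
  rw [continuous_iff_continuousAt]
  intro t
  refine continuousAt_of_dominated (bound := b) ?_ ?_ hb ?_
  · refine Eventually.of_forall fun t => Measurable.aestronglyMeasurable ?_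
    exact (hm.indicator (measurableSet_forall_le _ _ _)).comp
      (measurable_const.add measurable_subtype_coe)
  · exact Eventually.of_forall fun t => ae_of_all _ fun z => hbound _ _ _
  · have hne : ∀ᵐ z : (lam j).ker ∂Measure.addHaar, ∀ l, l ≠ j →
        lam l (t j • e j + (z : E)) ≠ t l := by
      rw [ae_all_iff]
      intro l
      by_cases hl : l = j
      · simp [hl]
      · obtain ⟨w, hw⟩ := hind l hl
        filter_upwards [ae_add_ne_of_linear_ne_zero Measure.addHaar
          ((lam l : E →ₗ[ℝ] ℝ).domRestrict (lam j).ker) (w := w) hw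
          (lam l (t j • e j)) (t l)] with z hz _
        rw [map_add]; exact hz
    filter_upwards [hne, hcont (t j)] with z hz hzc
    have hpt : Continuous fun t : ι → ℝ => t j • e j + (z : E) := by fun_prop
    -- Off the hyperplanes, either all constraints are strict and remain so nearby, or one is
    -- strictly violated and the integrand vanishes nearby.
    by_cases hall : ∀ l, l ≠ j → lam l (t j • e j + (z : E)) < t l
    · have hev : ∀ᶠ t' in 𝓝 t, ∀ l, l ≠ j → lam l (t' j • e j + (z : E)) < t' l := by
        rw [eventually_all]
        intro l
        by_cases hl : l = j
        · simp [hl]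
        · have : Continuous fun t' : ι → ℝ => lam l (t' j • e j + (z : E)) := by fun_prop
          filter_upwards [this.continuousAt.eventually_lt (continuous_apply l).continuousAt
            (hall l hl)] with t' ht' _ using ht'
      refine (ContinuousAt.comp (f := fun t : ι → ℝ => t j • e j + (z : E)) (g := ρ)
        hzc hpt.continuousAt).congr ?_
      filter_upwards [hev] with t' ht'
      rw [indicator_of_mem]
      · rfl
      · exact fun l hl => (ht' l hl).le
    · push Not at hall
      obtain ⟨l, hl, hlt⟩ := hall
      have hlt' := lt_of_le_of_ne hlt (hz l hl).symm
      have : Continuous fun t' : ι → ℝ => lam l (t' j • e j + (z : E)) := by fun_prop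
      refine (continuousAt_const (y := (0 : ℝ))).congr ?_
      filter_upwards [(continuous_apply l).continuousAt.eventually_lt this.continuousAt hlt']
        with t' ht'
      rw [indicator_of_notMem]
      exact fun h => absurd (h l hl) (not_le.2 ht')

/-- One point in the relative interior of the facet is enough: the integrand is positive on a
neighborhood of it in the slice, and Haar measure charges open sets. -/
theorem sliceMass_pos (hm : Measurable ρ) (hρ : ∀ x, 0 ≤ ρ x) (hC : ∀ x, |ρ x| ≤ C)
    (hR : ∀ x, R < ‖x‖ → ρ x = 0) (j : ι) (he : lam j (e j) = 1) (t : ι → ℝ) {q : E}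
    (hq : lam j q = t j) (hlt : ∀ l, l ≠ j → lam l q < t l) (hρq : ∀ᶠ x in 𝓝 q, 0 < ρ x) :
    0 < sliceMass lam ρ e j t := by
  obtain ⟨b, hb, hbound⟩ := exists_integrable_bound_slice hC hR (lam j) he
  have hint : Integrable (fun z : (lam j).ker =>
      {x | ∀ l, l ≠ j → lam l x ≤ t l}.indicator ρ (t j • e j + (z : E))) Measure.addHaar := by
    refine hb.mono' (Measurable.aestronglyMeasurable ?_) (ae_of_all _ fun z => hbound _ _ _)
    exact (hm.indicator (measurableSet_forall_le _ _ _)).comp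
      (measurable_const.add measurable_subtype_coe)
  rw [sliceMass, integral_pos_iff_support_of_nonneg
    (fun _ => indicator_nonneg (fun x _ => hρ x) _) hint]
  have hz₀ : q - t j • e j ∈ (lam j).ker := by
    change lam j (q - t j • e j) = 0
    simp [he, hq]
  have hev : ∀ᶠ x in 𝓝 q, (∀ l, l ≠ j → lam l x ≤ t l) ∧ 0 < ρ x := by
    refine Filter.Eventually.and ?_ hρq
    rw [eventually_all]
    intro l
    by_cases hl : l = j
    · simp [hl]
    · filter_upwards [(lam l).continuous.continuousAt.eventually_lt continuousAt_const
        (hlt l hl)] with x hx _ using hx.le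
  have hc : ContinuousAt (fun z : (lam j).ker => t j • e j + (z : E)) ⟨_, hz₀⟩ := by fun_prop
  have hc' := hc.tendsto
  simp only [add_sub_cancel] at hc'
  refine Measure.measure_pos_of_mem_nhds _ (x := (⟨_, hz₀⟩ : (lam j).ker)) ?_
  filter_upwards [hc'.eventually hev] with z hz
  have hz1 : t j • e j + (z : E) ∈ {x | ∀ l, l ≠ j → lam l x ≤ t l} := hz.1
  rw [Function.mem_support, indicator_of_mem hz1]
  exact hz.2.ne'

/-- The mass of a polyhedron `{x | ∀ l, lam l x ≤ t l}` is a differentiable function of `t`, with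
partial derivatives proportional to the masses of the facets. -/
theorem hasFDerivAt_setIntegral_polyhedron (μ : Measure E) [μ.IsAddHaarMeasure]
    (hm : Measurable ρ) (hC : ∀ x, |ρ x| ≤ C)
    (hR : ∀ x, R < ‖x‖ → ρ x = 0) (he : ∀ j, lam j (e j) = 1)
    (hind : ∀ j l, l ≠ j → ∃ w : (lam j).ker, lam l w ≠ 0)
    (hcont : ∀ j, ∀ s : ℝ, ∀ᵐ z : (lam j).ker ∂Measure.addHaar,
      ContinuousAt ρ (s • e j + (z : E))) :
    ∃ c : ι → ℝ, (∀ j, 0 < c j) ∧ ∀ t : ι → ℝ,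
      HasFDerivAt (fun t : ι → ℝ => ∫ x in {x | ∀ l, lam l x ≤ t l}, ρ x ∂μ)
        (∑ j, (c j * sliceMass lam ρ e j t) •
          ContinuousLinearMap.proj (R := ℝ) (φ := fun _ : ι => ℝ) j) t := by
  choose c hc0 hμ hemb using fun j =>
    exists_smul_map_slice μ (lam j) (he j) (Measure.addHaar : Measure (lam j).ker)
  refine ⟨fun j => c j, fun j => by simpa using pos_iff_ne_zero.2 (hc0 j), fun t₀ => ?_⟩
  have hcontΦ := fun j => continuous_sliceMass hm hC hR j (he j) (hind j) (hcont j)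
  refine hasFDerivAt_pi_of_continuousAt_partial
    (g := fun j t => c j * sliceMass lam ρ e j t)
    (fun j => ((hcontΦ j).const_mul _).continuousAt) fun j t => ?_
  set q : ℝ → ℝ := fun s => sliceMass lam ρ e j (Function.update t j s) with hq
  have hqc : Continuous q := (hcontΦ j).comp (by fun_prop)
  have hset : ∀ τ, MeasurableSet {x | ∀ l, lam l x ≤ Function.update t j τ l} := fun τ => by
    simpa using measurableSet_forall_le lam (fun _ => True) (Function.update t j τ)
  have hset' : MeasurableSet {x | ∀ l, l ≠ j → lam l x ≤ t l} := measurableSet_forall_le _ _ _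
  have hker : ∀ (s : ℝ) (z : (lam j).ker), lam j (s • e j + (z : E)) = s := by
    intro s z
    have : lam j (z : E) = 0 := z.2
    simp [he, this]
  have htrans : ∀ f : E → ℝ, Integrable f μ → Integrable
      (fun p : ℝ × (lam j).ker => f (p.1 • e j + (p.2 : E)))
        ((volume : Measure ℝ).prod Measure.addHaar) := by
    intro f hf
    rw [hμ j, ← Measure.coe_nnreal_smul, integrable_smul_measure (by simpa using hc0 j)
      ENNReal.coe_ne_top, (hemb j).integrable_map_iff] at hf
    exact hf
  have hρi : Integrable ρ μ := integrable_of_bounded_of_support hm hC hR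
  have hqeq : ∀ s, q s = ∫ z : (lam j).ker,
      {x | ∀ l, l ≠ j → lam l x ≤ t l}.indicator ρ (s • e j + (z : E)) ∂Measure.addHaar := by
    intro s
    simp only [hq, sliceMass, Function.update_self]
    congr 1
    ext z
    congr 1
    ext x
    simp only [mem_ofPred_eq]
    refine forall₂_congr fun l hl => ?_
    rw [Function.update_of_ne hl]
  have hqi : Integrable q := by
    have := (htrans _ (hρi.indicator hset')).integral_prod_left
    exact this.congr (ae_of_all _ fun s => (hqeq s).symm)
  -- In slice coordinates constraint `j` reads `s ≤ τ` and the others do not involve `τ`. The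
  -- fundamental theorem of calculus then applies to the continuous function `q`.
  have hF : ∀ τ, (∫ x in {x | ∀ l, lam l x ≤ Function.update t j τ l}, ρ x ∂μ) =
      c j * ∫ s in Iic τ, q s := by
    intro τ
    rw [← integral_indicator (hset τ)]
    conv_lhs => rw [hμ j]
    rw [integral_smul_nnreal_measure, (hemb j).integral_map,
      integral_prod _ (htrans _ (hρi.indicator (hset τ))), ← integral_indicator measurableSet_Iic]
    change (c j : ℝ) * _ = _
    congr 2
    ext s
    by_cases hs : s ∈ Iic τ
    · rw [indicator_of_mem hs, hqeq]
      congr 1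
      ext z
      refine indicator_eq_indicator ?_ rfl
      simp only [mem_ofPred_eq]
      constructor
      · intro h l hl
        simpa [hl] using h l
      · intro h l
        by_cases hl : l = j
        · subst hl
          rw [hker, Function.update_self]
          exact hs
        · simpa [hl] using h l hl
    · rw [indicator_of_notMem hs]
      refine integral_eq_zero_of_ae (ae_of_all _ fun z => ?_)
      refine indicator_of_notMem (fun h => hs ?_) _
      have := h j
      rwa [hker, Function.update_self] at this
  have hsub : ∀ τ, (∫ x in {x | ∀ l, lam l x ≤ Function.update t j τ l}, ρ x ∂μ) =
      c j * ((∫ s in (t j)..τ, q s) + ∫ s in Iic (t j), q s) := by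
    intro τ
    rw [hF, ← intervalIntegral.integral_Iic_sub_Iic hqi.integrableOn hqi.integrableOn]
    ring
  simp_rw [hsub]
  have hder := (hqc.integral_hasStrictDerivAt (t j) (t j)).hasDerivAt
  have hqt : q (t j) = sliceMass lam ρ e j t := by simp [hq]
  rw [hqt] at hder
  exact (hder.add_const _).const_mul _

end SliceMass

/-! ### Cells cut out of a simplex by affine functions -/

section AffineCells

open Filter Topology Set

variable {E : Type*} [NormedAddCommGroup E] [NormedSpace ℝ E] [FiniteDimensional ℝ E]
  [MeasurableSpace E] [BorelSpace E] {κ : Type*} [Fintype κ]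

omit [FiniteDimensional ℝ E] [MeasurableSpace E] [BorelSpace E] [Fintype κ] in
theorem AffineBasis.coord_add_apply (b : AffineBasis κ ℝ E) (m : κ) (x v : E) :
    b.coord m (x + v) = b.coord m x + (b.coord m).linear v := by
  rw [add_comm, ← vadd_eq_add, AffineMap.map_vadd, vadd_eq_add, add_comm]

omit [MeasurableSpace E] [BorelSpace E] in
theorem AffineBasis.eventually_mem_convexHull (b : AffineBasis κ ℝ E) {x : E}
    (hx : ∀ m, 0 < b.coord m x) : ∀ᶠ x' in 𝓝 x, x' ∈ convexHull ℝ (range b) := by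
  have : ∀ᶠ x' in 𝓝 x, ∀ m, 0 < b.coord m x' := by
    rw [eventually_all]
    exact fun m => continuousAt_const.eventually_lt
      (continuous_barycentric_coord b m).continuousAt (hx m)
  filter_upwards [this] with x' hx'
  rw [b.convexHull_eq_nonneg_coord]
  exact fun m => (hx' m).le

omit [MeasurableSpace E] [BorelSpace E] in
-- Away from the hyperplanes carrying the facets, a point is either interior to the simplex, or has
-- a negative barycentric coordinate and hence a neighborhood outside it.
theorem AffineBasis.continuousAt_indicator_convexHull (b : AffineBasis κ ℝ E) {ρ : E → ℝ}
    (hρ : ContinuousOn ρ (convexHull ℝ (range b))) {x : E} (hx : ∀ m, b.coord m x ≠ 0) :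
    ContinuousAt ((convexHull ℝ (range b)).indicator ρ) x := by
  by_cases hpos : ∀ m, 0 < b.coord m x
  · have hev := b.eventually_mem_convexHull hpos
    refine (hρ.continuousAt hev).congr ?_
    filter_upwards [hev] with x' hx'
    rw [indicator_of_mem hx']
  · push Not at hpos
    obtain ⟨m, hm⟩ := hpos
    have hm' := lt_of_le_of_ne hm (hx m)
    refine (continuousAt_const (y := (0 : ℝ))).congr ?_
    filter_upwards [(continuous_barycentric_coord b m).continuousAt.eventually_lt
      continuousAt_const hm'] with x' hx'
    rw [indicator_of_notMem]
    rw [b.convexHull_eq_nonneg_coord]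
    exact fun h => absurd (h m) (not_le.2 hx')

/-- Differentiability with respect to `ψ` of the mass of a cell
`{z | ∀ j, f i z + ψ i ≤ f j z + ψ j}` of a simplex, for affine functions `f j = g j + γ j` whose
differences are in general position with respect to each other and to the facets. -/
theorem exists_hasFDerivAt_setIntegral_affineCell (μ : Measure E) [μ.IsAddHaarMeasure]
    (b : AffineBasis κ ℝ E) {ρ : E → ℝ} (hρ : ContinuousOn ρ (convexHull ℝ (range b)))
    (hpos : ∀ x ∈ convexHull ℝ (range b), 0 < ρ x) {N : ℕ} (g : Fin N → E →L[ℝ] ℝ)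
    (γ : Fin N → ℝ) (i : Fin N) (hg : ∀ j, j ≠ i → ∃ w, (g i - g j) w ≠ 0)
    (hgg : ∀ j l, j ≠ i → l ≠ i → l ≠ j → ∃ w, (g i - g j) w = 0 ∧ (g i - g l) w ≠ 0)
    (hgb : ∀ j, j ≠ i → ∀ m, ∃ w, (g i - g j) w = 0 ∧ (b.coord m).linear w ≠ 0)
    (ψ : EuclideanSpace ℝ (Fin N)) :
    ∃ H : Fin N → ℝ, (∀ j, 0 ≤ H j) ∧
      HasFDerivAt (fun ψ : EuclideanSpace ℝ (Fin N) =>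
          ∫ z in {z | ∀ j, g i z + γ i + ψ i ≤ g j z + γ j + ψ j},
            (convexHull ℝ (range b)).indicator ρ z ∂μ)
        (∑ j, H j • (EuclideanSpace.proj j - EuclideanSpace.proj i :
          EuclideanSpace ℝ (Fin N) →L[ℝ] ℝ)) ψ ∧
      ∀ j, j ≠ i → (∃ q, (∀ m, 0 < b.coord m q) ∧ g i q + γ i + ψ i = g j q + γ j + ψ j ∧
        ∀ l, l ≠ i → l ≠ j → g i q + γ i + ψ i < g l q + γ l + ψ l) → 0 < H j := by
  classical
  set lam : {j // j ≠ i} → E →L[ℝ] ℝ := fun j => g i - g j with hlam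
  set ρ₀ := (convexHull ℝ (range b)).indicator ρ with hρ₀
  have hcomp : IsCompact (convexHull ℝ (range b)) := (finite_range b).isCompact_convexHull (𝕜 := ℝ)
  have hmeas : Measurable ρ₀ := by
    have := ContinuousOn.measurable_piecewise (g := fun _ => (0 : ℝ)) hρ
      continuous_const.continuousOn hcomp.isClosed.measurableSet
    rwa [show (fun _ : E => (0 : ℝ)) = 0 from rfl, piecewise_eq_indicator] at this
  obtain ⟨C, hC⟩ := hcomp.exists_bound_of_continuousOn hρ
  have hC0 : ∀ x, |ρ₀ x| ≤ max C 0 := by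
    intro x
    by_cases hx : x ∈ convexHull ℝ (range b)
    · rw [hρ₀, indicator_of_mem hx]
      exact (hC x hx).trans (le_max_left _ _)
    · rw [hρ₀, indicator_of_notMem hx]
      simp
  obtain ⟨R, hR⟩ := hcomp.isBounded.exists_norm_le
  have hR0 : ∀ x, R < ‖x‖ → ρ₀ x = 0 := fun x hx =>
    indicator_of_notMem (fun h => absurd (hR x h) (not_le.2 hx)) _
  have hnn : ∀ x, 0 ≤ ρ₀ x := indicator_nonneg fun x hx => (hpos x hx).le
  have hex : ∀ j : {j // j ≠ i}, ∃ e, lam j e = 1 := by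
    intro j
    obtain ⟨w, hw⟩ := hg j j.2
    refine ⟨(lam j w)⁻¹ • w, ?_⟩
    rw [map_smul, smul_eq_mul]
    exact inv_mul_cancel₀ hw
  choose e he using hex
  obtain ⟨c, hc, hF⟩ := hasFDerivAt_setIntegral_polyhedron μ hmeas hC0 hR0 he
    (fun j l hl => by
      obtain ⟨w, hw, hw'⟩ := hgg j l j.2 l.2 (fun h => hl (Subtype.ext h))
      exact ⟨⟨w, hw⟩, hw'⟩)
    (fun j s => by
      have : ∀ᵐ z : (lam j).ker ∂Measure.addHaar, ∀ m, b.coord m (s • e j + (z : E)) ≠ 0 := by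
        rw [ae_all_iff]
        intro m
        obtain ⟨w, hw, hw'⟩ := hgb j j.2 m
        filter_upwards [ae_add_ne_of_linear_ne_zero Measure.addHaar
          ((b.coord m).linear.domRestrict (lam j).ker) (w := ⟨w, hw⟩) hw'
          (b.coord m (s • e j)) 0] with z hz
        rw [b.coord_add_apply]
        exact hz
      filter_upwards [this] with z hz
      exact b.continuousAt_indicator_convexHull hρ hz)
  set t : EuclideanSpace ℝ (Fin N) → ({j // j ≠ i} → ℝ) :=
    fun ψ j => (EuclideanSpace.proj j.1 - EuclideanSpace.proj i :
      EuclideanSpace ℝ (Fin N) →L[ℝ] ℝ) ψ + (γ j - γ i) with ht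
  have htder : HasFDerivAt t (ContinuousLinearMap.pi fun j : {j // j ≠ i} =>
      (EuclideanSpace.proj j.1 - EuclideanSpace.proj i :
        EuclideanSpace ℝ (Fin N) →L[ℝ] ℝ)) ψ :=
    hasFDerivAt_pi.2 fun j => (ContinuousLinearMap.hasFDerivAt _).add_const _
  have hset : ∀ ψ : EuclideanSpace ℝ (Fin N),
      {z | ∀ j, g i z + γ i + ψ i ≤ g j z + γ j + ψ j} = {x | ∀ l, lam l x ≤ t ψ l} := by
    intro ψ
    ext z
    simp only [mem_ofPred_eq, hlam, ht, Subtype.forall]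
    refine forall_congr' fun j => ?_
    by_cases hj : j = i
    · simp [hj]
    · simp only [ne_eq, hj, not_false_eq_true, forall_true_left, _root_.sub_apply,
        PiLp.proj_apply]
      constructor <;> intro h <;> linarith
  simp_rw [hset]
  -- The value at `j = i` is immaterial, since it multiplies `proj i - proj i = 0`.
  refine ⟨fun j => if h : j ≠ i then c ⟨j, h⟩ * sliceMass lam ρ₀ e ⟨j, h⟩ (t ψ) else 0, ?_, ?_, ?_⟩
  · intro j
    dsimp only
    split_ifs with h
    · exact mul_nonneg (hc _).le (sliceMass_nonneg hnn _ _)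
    · exact le_rfl
  · refine ((hF (t ψ)).comp ψ htder).congr_fderiv ?_
    ext v
    simp only [ContinuousLinearMap.comp_apply, _root_.sum_apply,
      _root_.smul_apply, ContinuousLinearMap.proj_apply, ContinuousLinearMap.pi_apply]
    rw [← Finset.sum_erase Finset.univ (a := i) (by simp),
      Finset.sum_subtype (Finset.univ.erase i) (p := fun j => j ≠ i) (by simp)]
    refine Finset.sum_congr rfl fun j _ => ?_
    rw [dif_pos j.2]
  · rintro j hj ⟨q, hq, heq, hlt⟩
    beta_reduce
    rw [dif_pos hj]
    refine mul_pos (hc _) (sliceMass_pos hmeas hnn hC0 hR0 _ (he _) _ (q := q) ?_ ?_ ?_)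
    · simp only [hlam, ht, _root_.sub_apply, PiLp.proj_apply]
      linarith
    · rintro ⟨l, hl⟩ hlj
      have := hlt l hl fun h => hlj (Subtype.ext h)
      simp only [hlam, ht, _root_.sub_apply, PiLp.proj_apply]
      linarith
    · filter_upwards [b.eventually_mem_convexHull hq] with x hx
      rw [hρ₀, indicator_of_mem hx]
      exact hpos x hx

end AffineCells

/-! ### Isolated points and interior points of an interface -/

section FaceDirection

open Filter Topology Set

variable {E : Type*} [NormedAddCommGroup E] [NormedSpace ℝ E] {κ : Type*} [Fintype κ]

/-- The direction of the face of a simplex spanned by the vertices in `P`. -/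
noncomputable def AffineBasis.faceDirection (b : AffineBasis κ ℝ E) (P : Finset κ) : Submodule ℝ E :=
  ⨅ m : {m // m ∉ P}, LinearMap.ker (b.coord m.1).linear

omit [Fintype κ] in
theorem AffineBasis.mem_faceDirection {b : AffineBasis κ ℝ E} {P : Finset κ} {u : E} :
    u ∈ b.faceDirection P ↔ ∀ m ∉ P, (b.coord m).linear u = 0 := by
  simp [faceDirection, Submodule.mem_iInf]

omit [Fintype κ] in
theorem AffineBasis.linear_coord_sub (b : AffineBasis κ ℝ E) (m : κ) (x z : E) :
    (b.coord m).linear (x - z) = b.coord m x - b.coord m z := by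
  rw [← vsub_eq_sub, AffineMap.linearMap_vsub, vsub_eq_sub]

/-- The vertices of the smallest face containing `z`. -/
noncomputable def AffineBasis.carrier (b : AffineBasis κ ℝ E) (z : E) : Finset κ :=
  open Classical in Finset.univ.filter fun m => 0 < b.coord m z

theorem AffineBasis.mem_carrier {b : AffineBasis κ ℝ E} {z : E} {m : κ} :
    m ∈ b.carrier z ↔ 0 < b.coord m z := by
  simp [carrier]

theorem AffineBasis.coord_eq_zero_of_notMem_carrier {b : AffineBasis κ ℝ E} {z : E}
    (hz : z ∈ convexHull ℝ (range b)) {m : κ} (hm : m ∉ b.carrier z) : b.coord m z = 0 := by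
  rw [b.convexHull_eq_nonneg_coord] at hz
  exact le_antisymm (not_lt.1 fun h => hm (mem_carrier.2 h)) (hz m)

/-- The indices of the functions which are minimal at `z`. -/
noncomputable def minimizers {N : ℕ} (f : Fin N → E → ℝ) (z : E) : Finset (Fin N) :=
  open Classical in Finset.univ.filter fun i => ∀ j, f i z ≤ f j z

omit [NormedAddCommGroup E] [NormedSpace ℝ E] in
theorem mem_minimizers {N : ℕ} {f : Fin N → E → ℝ} {z : E} {i : Fin N} :
    i ∈ minimizers f z ↔ ∀ j, f i z ≤ f j z := by
  simp [minimizers]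

/-- The points `z` of a simplex which are isolated in the set of points with the same smallest face
and the same minimizers of the affine functions `g i + τ i`. -/
def isolatedPoints (b : AffineBasis κ ℝ E) {N : ℕ} (g : Fin N → E →L[ℝ] ℝ) (τ : Fin N → ℝ) :
    Set E :=
  {z ∈ convexHull ℝ (range b) | ∀ u ∈ b.faceDirection (b.carrier z),
    (∀ i ∈ minimizers (fun i z => g i z + τ i) z, ∀ j ∈ minimizers (fun i z => g i z + τ i) z,
      (g i - g j) u = 0) → u = 0}

/-- An isolated point is determined by its carrier and its minimizers: the difference of two points
with the same data is a direction that the defining condition forces to vanish. Only finitely many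
such pairs exist. -/
theorem finite_isolatedPoints (b : AffineBasis κ ℝ E) {N : ℕ} (g : Fin N → E →L[ℝ] ℝ)
    (τ : Fin N → ℝ) : (isolatedPoints b g τ).Finite := by
  refine Finite.of_injOn (t := univ)
    (f := fun z => (b.carrier z, minimizers (fun i z => g i z + τ i) z))
    (mapsTo_univ _ _) ?_ finite_univ
  rintro z ⟨hz, hzu⟩ z' ⟨hz', -⟩ heq
  obtain ⟨hP, hA⟩ := Prod.mk.inj heq
  refine sub_eq_zero.1 (hzu (z - z') ?_ ?_)
  · refine AffineBasis.mem_faceDirection.2 fun m hm => ?_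
    rw [b.linear_coord_sub, AffineBasis.coord_eq_zero_of_notMem_carrier hz hm,
      AffineBasis.coord_eq_zero_of_notMem_carrier hz' (hP ▸ hm), sub_zero]
  · intro i hi j hj
    have h1 := mem_minimizers.1 hi j
    have h2 := mem_minimizers.1 hj i
    rw [hA] at hi hj
    have h3 := mem_minimizers.1 hi j
    have h4 := mem_minimizers.1 hj i
    simp only [_root_.sub_apply, map_sub]
    linarith

/-- If the functions `g i` are in general position with respect to the faces of a simplex, then near
a nonisolated point where `i` and `j` are minimizers, there are interior points where `i` and `j` are
the only minimizers. -/
theorem exists_interior_point_two_minimizers [FiniteDimensional ℝ E] (b : AffineBasis κ ℝ E)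
    {N : ℕ} (g : Fin N → E →L[ℝ] ℝ)
    (hsurj : ∀ (P : Finset κ) (A : Finset (Fin N)), ∀ i ∈ A, 2 ≤ A.card → A.card ≤ P.card →
      ∀ c : Fin N → ℝ, ∃ u ∈ b.faceDirection P, ∀ l ∈ A, l ≠ i → (g l - g i) u = c l)
    (hinj : ∀ (P : Finset κ) (A : Finset (Fin N)), ∀ i ∈ A, 2 ≤ A.card → P.card ≤ A.card →
      ∀ u ∈ b.faceDirection P, (∀ l ∈ A, (g l - g i) u = 0) → u = 0)
    (τ : Fin N → ℝ) {z : E} (hz : z ∈ convexHull ℝ (range b)) (hz' : z ∉ isolatedPoints b g τ)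
    {i j : Fin N} (hij : j ≠ i) (hi : ∀ l, g i z + τ i ≤ g l z + τ l)
    (hj : ∀ l, g j z + τ j ≤ g l z + τ l) :
    ∃ q, (∀ m, 0 < b.coord m q) ∧ g i q + τ i = g j q + τ j ∧
      ∀ l, l ≠ i → l ≠ j → g i q + τ i < g l q + τ l := by
  set A := minimizers (fun i z => g i z + τ i) z with hA
  set P := b.carrier z with hP
  have hiA : i ∈ A := mem_minimizers.2 hi
  have hjA : j ∈ A := mem_minimizers.2 hj
  have hA2 : 2 ≤ A.card := Finset.one_lt_card.2 ⟨i, hiA, j, hjA, hij.symm⟩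
  -- With more minimizers than vertices, `hinj` would make `z` isolated.
  have hAP : A.card ≤ P.card := by
    by_contra hcon
    refine hz' ⟨hz, fun u hu huA => hinj P A i hiA hA2 (not_le.1 hcon).le u hu fun l hl => ?_⟩
    exact huA l hl i hiA
  obtain ⟨c, hc⟩ : ∃ c, ∀ m, 0 < b.coord m c := by
    have := b.centroid_mem_interior_convexHull
    rw [b.interior_convexHull] at this
    exact ⟨_, this⟩
  -- The direction `c - z` points into the interior; the correction `u`, tangent to the face of `z`,
  -- keeps it so. The prescribed values make `g l - g i` equal to `0` on `w` for `l = j` and to `1`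
  -- for every other minimizer, so a small step along `w` keeps only the tie between `i` and `j`.
  obtain ⟨u, hu, hul⟩ := hsurj P A i hiA hA2 hAP
    fun l => (if l = j then 0 else 1) - (g l - g i) (c - z)
  set w := c - z + u with hw
  have hwj : g j w = g i w := by
    have := hul j hjA hij
    simp only [if_true, _root_.sub_apply, map_sub, hw, map_add] at this ⊢
    linarith
  have hwl : ∀ l ∈ A, l ≠ i → l ≠ j → g l w = g i w + 1 := by
    intro l hl hli hlj
    have := hul l hl hli
    simp only [hlj, if_false, _root_.sub_apply, map_sub, hw, map_add] at this ⊢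
    linarith
  have hvz : g i z + τ i = g j z + τ j := le_antisymm (hi j) (hj i)
  have hev1 : ∀ᶠ ε : ℝ in 𝓝[>] 0, ∀ m, 0 < b.coord m (z + ε • w) := by
    rw [eventually_all]
    intro m
    by_cases hm : m ∈ P
    · have hcont : Continuous fun ε : ℝ => b.coord m (z + ε • w) :=
        (continuous_barycentric_coord b m).comp (by fun_prop)
      refine (hcont.tendsto 0).mono_left nhdsWithin_le_nhds |>.eventually_const_lt ?_
      simpa using AffineBasis.mem_carrier.1 hm
    -- Both `z` and the direction `u` have zero `m`-component here, so the coordinate is `ε` times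
    -- the positive coordinate of `c`.
    · filter_upwards [self_mem_nhdsWithin] with ε hε
      rw [b.coord_add_apply, AffineBasis.coord_eq_zero_of_notMem_carrier hz hm, map_smul, hw,
        map_add, b.linear_coord_sub, AffineBasis.coord_eq_zero_of_notMem_carrier hz hm,
        AffineBasis.mem_faceDirection.1 hu m hm, zero_add, sub_zero, add_zero, smul_eq_mul]
      exact mul_pos hε (hc m)
  have hev2 : ∀ᶠ ε : ℝ in 𝓝[>] 0, ∀ l, l ≠ i → l ≠ j →
      g i (z + ε • w) + τ i < g l (z + ε • w) + τ l := by
    rw [eventually_all]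
    intro l
    by_cases hl : l ∈ A
    · filter_upwards [self_mem_nhdsWithin] with ε hε hli hlj
      have h1 := mem_minimizers.1 hl i
      have h2 := hi l
      have h3 : (0 : ℝ) < ε := hε
      simp only [map_add, map_smul, smul_eq_mul, hwl l hl hli hlj]
      linarith
    · have hlt : g i z + τ i < g l z + τ l := by
        by_contra hcon
        exact hl (mem_minimizers.2 fun l' => (not_lt.1 hcon).trans (hi l'))
      have hcont : Continuous fun ε : ℝ =>
          g l (z + ε • w) + τ l - (g i (z + ε • w) + τ i) := by fun_prop
      filter_upwards [(hcont.tendsto 0).mono_left nhdsWithin_le_nhds |>.eventually_const_lt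
        (u := 0) (by simpa using hlt)] with ε hε _ _
      linarith
  obtain ⟨ε, h1, h2⟩ := (hev1.and hev2).exists
  refine ⟨z + ε • w, h1, ?_, h2⟩
  simp only [map_add, map_smul, hwj]
  linarith

end FaceDirection

/-! ### Face directions as spans of edge vectors -/

/-- Translates between the finsets used for faces and minimizers and the indexed families of the
genericity condition, with a chosen base index. -/
theorem Finset.exists_injective_enumeration {α : Type*} {s : Finset α} {a : α}
    (ha : a ∈ s) {n : ℕ} (hs : s.card = n + 1) :
    ∃ f : Fin (n + 1) → α, Function.Injective f ∧ f 0 = a ∧ ∀ x, x ∈ s ↔ ∃ k, f k = x := by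
  classical
  have hcard : (s.erase a).card = n := by rw [Finset.card_erase_of_mem ha, hs]; rfl
  let e := (s.erase a).equivFinOfCardEq hcard
  refine ⟨Fin.cons a fun k => (e.symm k : α), ?_, rfl, fun x => ?_⟩
  · rw [Fin.cons_injective_iff]
    refine ⟨?_, Subtype.val_injective.comp e.symm.injective⟩
    rintro ⟨k, hk⟩
    exact Finset.ne_of_mem_erase (e.symm k).2 hk
  · rw [Fin.exists_fin_succ]
    simp only [Fin.cons_zero, Fin.cons_succ]
    constructor
    · intro hx
      by_cases hxa : a = x
      · exact Or.inl hxa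
      · exact Or.inr ⟨e ⟨x, Finset.mem_erase.2 ⟨Ne.symm hxa, hx⟩⟩, by simp⟩
    · rintro (rfl | ⟨k, rfl⟩)
      · exact ha
      · exact Finset.mem_of_mem_erase (e.symm k).2

section FaceSpan

open Set

variable {E : Type*} [NormedAddCommGroup E] [NormedSpace ℝ E] {κ : Type*} [Fintype κ]

theorem AffineBasis.sum_linear_coord_smul (b : AffineBasis κ ℝ E) (u : E) :
    ∑ m, (b.coord m).linear u • b m = u := by
  have h1 := b.linear_combination_coord_eq_self u
  have h2 := b.linear_combination_coord_eq_self 0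
  have : ∀ m, (b.coord m).linear u = b.coord m u - b.coord m 0 := fun m => by
    rw [← b.linear_coord_sub, sub_zero]
  simp_rw [this, sub_smul, Finset.sum_sub_distrib]
  rw [h1, h2, sub_zero]

theorem AffineBasis.sum_linear_coord (b : AffineBasis κ ℝ E) (u : E) :
    ∑ m, (b.coord m).linear u = 0 := by
  have : ∀ m, (b.coord m).linear u = b.coord m u - b.coord m 0 := fun m => by
    rw [← b.linear_coord_sub, sub_zero]
  simp_rw [this, Finset.sum_sub_distrib]
  rw [b.sum_coord_apply_eq_one, b.sum_coord_apply_eq_one, sub_self]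

theorem AffineBasis.eq_zero_of_mem_faceDirection_of_card_le_one (b : AffineBasis κ ℝ E)
    {P : Finset κ} (hP : P.card ≤ 1) {u : E} (hu : u ∈ b.faceDirection P) : u = 0 := by
  rw [b.mem_faceDirection] at hu
  have hall : ∀ m, (b.coord m).linear u = 0 := by
    intro m
    by_cases hm : m ∈ P
    · have hsum := b.sum_linear_coord u
      rwa [Finset.sum_eq_single m (fun m' _ hne => hu m' fun h =>
        hne (Finset.card_le_one.1 hP _ h _ hm)) (by simp)] at hsum
    · exact hu m hm
  rw [← b.sum_linear_coord_smul u]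
  exact Finset.sum_eq_zero fun m _ => by rw [hall, zero_smul]

theorem AffineBasis.faceDirection_eq_span (b : AffineBasis κ ℝ E) {P : Finset κ} {p : ℕ}
    {j : Fin (p + 1) → κ} (hj : Function.Injective j) (hP : ∀ x, x ∈ P ↔ ∃ a, j a = x) :
    b.faceDirection P = Submodule.span ℝ (range fun a : Fin p => b (j a.succ) - b (j 0)) := by
  classical
  have hPim : P = Finset.univ.image j := by ext x; simp [hP]
  apply le_antisymm
  · intro u hu
    rw [b.mem_faceDirection] at hu
    have h1 : u = ∑ a, (b.coord (j a)).linear u • b (j a) := by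
      rw [← Finset.sum_image (f := fun m => (b.coord m).linear u • b m) hj.injOn, ← hPim]
      conv_lhs => rw [← b.sum_linear_coord_smul u]
      refine (Finset.sum_subset (Finset.subset_univ _) fun m _ hm => ?_).symm
      rw [hu m hm, zero_smul]
    have h2 : ∑ a, (b.coord (j a)).linear u = 0 := by
      rw [← Finset.sum_image (f := fun m => (b.coord m).linear u) hj.injOn, ← hPim,
        ← b.sum_linear_coord u]
      exact Finset.sum_subset (Finset.subset_univ _) fun m _ hm => hu m hm
    have h3 : u = ∑ a, (b.coord (j a)).linear u • (b (j a) - b (j 0)) := by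
      simp_rw [smul_sub, Finset.sum_sub_distrib]
      rw [← Finset.sum_smul, h2, zero_smul, sub_zero, ← h1]
    rw [h3, Fin.sum_univ_succ, sub_self, smul_zero, zero_add]
    exact Submodule.sum_mem _ fun a _ =>
      Submodule.smul_mem _ _ (Submodule.subset_span (mem_range_self a))
  · rw [Submodule.span_le]
    rintro _ ⟨a, rfl⟩
    refine b.mem_faceDirection.2 fun m hm => ?_
    rw [b.linear_coord_sub, b.coord_apply_ne, b.coord_apply_ne, sub_zero]
    · rintro rfl; exact hm ((hP _).2 ⟨_, rfl⟩)
    · rintro rfl; exact hm ((hP _).2 ⟨_, rfl⟩)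

end FaceSpan

/-! ### Genericity in the chart of a simplex -/

section Generic

open Set

variable {d N k : ℕ} {y : Fin N → EuclideanSpace ℝ (Fin d)}
  {σ : Affine.Simplex ℝ (EuclideanSpace ℝ (Fin d)) k}

theorem Affine.Simplex.dim_le (σ : Affine.Simplex ℝ (EuclideanSpace ℝ (Fin d)) k) : k ≤ d := by
  have h1 := σ.independent.finrank_vectorSpan (n := k) (by simp)
  have h2 := Submodule.finrank_le (vectorSpan ℝ (range σ.points))
  rwa [h1, finrank_euclideanSpace_fin] at h2

/-- Rank-nullity: the face direction has dimension `p` by affine independence, and genericity says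
that the kernel has dimension `p - l`, so the rank is `l`. -/
theorem SimplexSoup.IsGenericForSimplex.surjective (hy : SimplexSoup.IsGenericForSimplex y σ)
    {p l : ℕ} (hl : 1 ≤ l) (hlp : l ≤ p) {i : Fin (l + 1) → Fin N} (hi : Function.Injective i)
    {j : Fin (p + 1) → Fin (k + 1)} (hj : Function.Injective j) (c : Fin l → ℝ) :
    ∃ u ∈ Submodule.span ℝ (range fun b : Fin p => σ.points (j b.succ) - σ.points (j 0)),
      ∀ a, inner ℝ (y (i a.succ) - y (i 0)) u = c a := by
  have hpk : p ≤ k := by simpa using Fintype.card_le_of_injective j hj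
  have hlN : l ≤ N - 1 := by
    have := Fintype.card_le_of_injective i hi
    simp only [Fintype.card_fin] at this
    omega
  have hkd := σ.dim_le
  have hfin := hy p (hl.trans hlp) hpk l hl (le_min (by omega) hlN) i hi j hj
  set U := Submodule.span ℝ (range fun b : Fin p => σ.points (j b.succ) - σ.points (j 0)) with hU
  have hUfin : Module.finrank ℝ U = p := by
    have hind := σ.independent.comp_embedding ⟨j, hj⟩
    rw [affineIndependent_iff_linearIndependent_vsub ℝ _ 0] at hind
    have := hind.comp (fun a : Fin p => (⟨a.succ, Fin.succ_ne_zero a⟩ : {x : Fin (p + 1) // x ≠ 0}))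
      (fun a a' h => Fin.succ_injective p (Subtype.ext_iff.1 h))
    have h2 := finrank_span_eq_card this
    exact h2.trans (Fintype.card_fin p)
  let T : U →ₗ[ℝ] (Fin l → ℝ) := LinearMap.pi fun a =>
    ((innerSL ℝ (y (i a.succ) - y (i 0))).toLinearMap).comp U.subtype
  have hker : (LinearMap.ker T).map U.subtype =
      (Submodule.span ℝ (range fun a : Fin l => y (i a.succ) - y (i 0)))ᗮ ⊓ U := by
    ext u
    simp only [Submodule.mem_map, LinearMap.mem_ker, Submodule.mem_inf, Submodule.mem_orthogonal]
    constructor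
    · rintro ⟨u, hu, rfl⟩
      refine ⟨fun v hv => ?_, u.2⟩
      induction hv using Submodule.span_induction with
      | mem v hv =>
        obtain ⟨a, rfl⟩ := hv
        exact congrFun hu a
      | zero => simp
      | add v w _ _ h1 h2 => rw [inner_add_left, h1, h2, add_zero]
      | smul r v _ h => rw [inner_smul_left, h, mul_zero]
    · rintro ⟨hu, huU⟩
      exact ⟨⟨u, huU⟩, funext fun a => hu _ (Submodule.subset_span (mem_range_self a)), rfl⟩
  have hkerfin : Module.finrank ℝ (LinearMap.ker T) = p - l := by
    rw [← hfin, ← hker, Submodule.finrank_map_subtype_eq]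
  have hrange : LinearMap.range T = ⊤ := by
    apply Submodule.eq_top_of_finrank_eq
    have := T.finrank_range_add_finrank_ker
    rw [hkerfin, hUfin] at this
    rw [Module.finrank_fin_fun]
    omega
  obtain ⟨u, hu⟩ := LinearMap.range_eq_top.1 hrange c
  exact ⟨u, u.2, fun a => congrFun hu a⟩

/-- The case `l = p` of genericity, in which the intersection has dimension `0`. -/
theorem SimplexSoup.IsGenericForSimplex.eq_zero (hy : SimplexSoup.IsGenericForSimplex y σ)
    {p : ℕ} (hp : 1 ≤ p) {i : Fin (p + 1) → Fin N} (hi : Function.Injective i)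
    {j : Fin (p + 1) → Fin (k + 1)} (hj : Function.Injective j) {u : EuclideanSpace ℝ (Fin d)}
    (hu : u ∈ Submodule.span ℝ (range fun b : Fin p => σ.points (j b.succ) - σ.points (j 0)))
    (hperp : ∀ a : Fin p, inner ℝ (y (i a.succ) - y (i 0)) u = 0) : u = 0 := by
  have hpk : p ≤ k := by simpa using Fintype.card_le_of_injective j hj
  have hpN : p ≤ N - 1 := by
    have := Fintype.card_le_of_injective i hi
    simp only [Fintype.card_fin] at this
    omega
  have hkd := σ.dim_le
  have hfin := hy p hp hpk p hp (le_min (by omega) hpN) i hi j hj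
  rw [Nat.sub_self, Submodule.finrank_eq_zero] at hfin
  rw [← Submodule.mem_bot ℝ, ← hfin]
  refine ⟨?_, hu⟩
  rw [SetLike.mem_coe, Submodule.mem_orthogonal]
  intro v hv
  induction hv using Submodule.span_induction with
  | mem v hv =>
    obtain ⟨a, rfl⟩ := hv
    exact hperp a
  | zero => simp
  | add v w _ _ h1 h2 => rw [inner_add_left, h1, h2, add_zero]
  | smul r v _ h => rw [inner_smul_left, h, mul_zero]

/-- The isometric parametrization of the affine span of a simplex by its direction. -/
noncomputable def Affine.Simplex.chart (σ : Affine.Simplex ℝ (EuclideanSpace ℝ (Fin d)) k) :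
    vectorSpan ℝ (range σ.points) →ᵃ[ℝ] EuclideanSpace ℝ (Fin d) :=
  (vectorSpan ℝ (range σ.points)).subtype.toAffineMap + AffineMap.const ℝ _ (σ.points 0)

theorem Affine.Simplex.chart_apply (σ : Affine.Simplex ℝ (EuclideanSpace ℝ (Fin d)) k)
    (z : vectorSpan ℝ (range σ.points)) : σ.chart z = z + σ.points 0 := rfl

theorem Affine.Simplex.isometry_chart (σ : Affine.Simplex ℝ (EuclideanSpace ℝ (Fin d)) k) :
    Isometry σ.chart :=
  Isometry.of_dist_eq fun z w => by simp [chart_apply, Subtype.dist_eq]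

/-- The vertices of a simplex, as an affine basis of its direction. -/
noncomputable def Affine.Simplex.directionBasis
    (σ : Affine.Simplex ℝ (EuclideanSpace ℝ (Fin d)) k) :
    AffineBasis (Fin (k + 1)) ℝ (vectorSpan ℝ (range σ.points)) where
  toFun m := ⟨σ.points m - σ.points 0, vsub_mem_vectorSpan ℝ (mem_range_self m) (mem_range_self 0)⟩
  ind' := by
    refine AffineIndependent.of_comp σ.chart ?_
    convert σ.independent
    ext1 m
    simp [chart_apply]
  tot' := by
    have h : AffineIndependent ℝ (fun m => (⟨σ.points m - σ.points 0,
        vsub_mem_vectorSpan ℝ (mem_range_self m) (mem_range_self 0)⟩ :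
          vectorSpan ℝ (range σ.points))) := by
      refine AffineIndependent.of_comp σ.chart ?_
      convert σ.independent
      ext1 m
      simp [chart_apply]
    rw [h.affineSpan_eq_top_iff_card_eq_finrank_add_one]
    simp [σ.independent.finrank_vectorSpan (n := k) (by simp)]

theorem Affine.Simplex.coe_directionBasis (σ : Affine.Simplex ℝ (EuclideanSpace ℝ (Fin d)) k)
    (m : Fin (k + 1)) :
    (σ.directionBasis m : EuclideanSpace ℝ (Fin d)) = σ.points m - σ.points 0 := rfl

theorem Affine.Simplex.chart_directionBasis (σ : Affine.Simplex ℝ (EuclideanSpace ℝ (Fin d)) k)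
    (m : Fin (k + 1)) : σ.chart (σ.directionBasis m) = σ.points m := by
  simp [chart_apply, coe_directionBasis]

theorem Affine.Simplex.chart_image_convexHull
    (σ : Affine.Simplex ℝ (EuclideanSpace ℝ (Fin d)) k) :
    σ.chart '' convexHull ℝ (range σ.directionBasis) = convexHull ℝ (range σ.points) := by
  rw [AffineMap.image_convexHull, ← range_comp]
  congr 2
  ext1 m
  exact σ.chart_directionBasis m

theorem Affine.Simplex.chart_preimage_convexHull
    (σ : Affine.Simplex ℝ (EuclideanSpace ℝ (Fin d)) k) :
    σ.chart ⁻¹' convexHull ℝ (range σ.points) = convexHull ℝ (range σ.directionBasis) := by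
  rw [← σ.chart_image_convexHull, preimage_image_eq _ σ.isometry_chart.injective]

theorem Affine.Simplex.map_faceDirection (σ : Affine.Simplex ℝ (EuclideanSpace ℝ (Fin d)) k)
    {P : Finset (Fin (k + 1))} {p : ℕ}
    {j : Fin (p + 1) → Fin (k + 1)} (hj : Function.Injective j) (hP : ∀ x, x ∈ P ↔ ∃ a, j a = x)
    (u : vectorSpan ℝ (range σ.points)) :
    u ∈ σ.directionBasis.faceDirection P ↔ (u : EuclideanSpace ℝ (Fin d)) ∈
      Submodule.span ℝ (range fun b : Fin p => σ.points (j b.succ) - σ.points (j 0)) := by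
  have : Submodule.span ℝ (range fun b : Fin p => σ.points (j b.succ) - σ.points (j 0)) =
      (σ.directionBasis.faceDirection P).map (vectorSpan ℝ (range σ.points)).subtype := by
    rw [σ.directionBasis.faceDirection_eq_span hj hP, Submodule.map_span, ← range_comp]
    congr 2
    ext1 a
    simp [coe_directionBasis]
  rw [this]
  simp

/-- The linear part of `x ↦ ‖x - y i‖ ^ 2 - ‖x‖ ^ 2` on the direction of a simplex. -/
noncomputable def Affine.Simplex.powerForm (σ : Affine.Simplex ℝ (EuclideanSpace ℝ (Fin d)) k)
    (y : Fin N → EuclideanSpace ℝ (Fin d)) (i : Fin N) :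
    vectorSpan ℝ (range σ.points) →L[ℝ] ℝ :=
  (innerSL ℝ ((-2 : ℝ) • y i)).comp (vectorSpan ℝ (range σ.points)).subtypeL

theorem Affine.Simplex.powerForm_apply (σ : Affine.Simplex ℝ (EuclideanSpace ℝ (Fin d)) k)
    (i : Fin N) (u : vectorSpan ℝ (range σ.points)) :
    σ.powerForm y i u = -2 * inner ℝ (y i) (u : EuclideanSpace ℝ (Fin d)) := by
  simp [powerForm]

theorem Affine.Simplex.powerForm_sub_apply (σ : Affine.Simplex ℝ (EuclideanSpace ℝ (Fin d)) k)
    (i j : Fin N) (u : vectorSpan ℝ (range σ.points)) :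
    (σ.powerForm y i - σ.powerForm y j) u =
      -2 * inner ℝ (y i - y j) (u : EuclideanSpace ℝ (Fin d)) := by
  rw [_root_.sub_apply, σ.powerForm_apply, σ.powerForm_apply, inner_sub_left]
  ring

theorem SimplexSoup.IsGenericForSimplex.powerForm_surjective
    (hy : SimplexSoup.IsGenericForSimplex y σ)
    (P : Finset (Fin (k + 1))) (A : Finset (Fin N)) (i : Fin N) (hi : i ∈ A) (hA : 2 ≤ A.card)
    (hAP : A.card ≤ P.card) (c : Fin N → ℝ) :
    ∃ u ∈ σ.directionBasis.faceDirection P, ∀ l ∈ A, l ≠ i →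
      (σ.powerForm y l - σ.powerForm y i) u = c l := by
  obtain ⟨n, hn⟩ : ∃ n, A.card = n + 1 := ⟨A.card - 1, by omega⟩
  obtain ⟨p, hp⟩ : ∃ p, P.card = p + 1 := ⟨P.card - 1, by omega⟩
  obtain ⟨m₀, hm₀⟩ := Finset.card_pos.1 (show 0 < P.card by omega)
  obtain ⟨f, hf, hf0, hfA⟩ := Finset.exists_injective_enumeration hi hn
  obtain ⟨j, hj, -, hjP⟩ := Finset.exists_injective_enumeration hm₀ hp
  -- The factor `-1/2` undoes the `-2` in `powerForm`.
  obtain ⟨u, hu, huc⟩ := hy.surjective (by omega) (by omega) hf hj fun a => -(c (f a.succ) / 2)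
  have hmem : u ∈ vectorSpan ℝ (range σ.points) := by
    refine Submodule.span_le.2 ?_ hu
    rintro _ ⟨b, rfl⟩
    exact vsub_mem_vectorSpan ℝ (mem_range_self _) (mem_range_self _)
  refine ⟨⟨u, hmem⟩, (σ.map_faceDirection hj hjP _).2 hu, fun l hl hli => ?_⟩
  obtain ⟨a, rfl⟩ := (hfA l).1 hl
  obtain ⟨a, rfl⟩ := Fin.exists_succ_eq.2 (show a ≠ 0 by rintro rfl; exact hli hf0)
  have := huc a
  rw [hf0] at this
  rw [σ.powerForm_sub_apply, this]
  ring

theorem SimplexSoup.IsGenericForSimplex.powerForm_injective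
    (hy : SimplexSoup.IsGenericForSimplex y σ)
    (P : Finset (Fin (k + 1))) (A : Finset (Fin N)) (i : Fin N) (hi : i ∈ A)
    (hPA : P.card ≤ A.card) (u : vectorSpan ℝ (range σ.points))
    (hu : u ∈ σ.directionBasis.faceDirection P)
    (hperp : ∀ l ∈ A, (σ.powerForm y l - σ.powerForm y i) u = 0) : u = 0 := by
  by_cases hP1 : P.card ≤ 1
  · exact σ.directionBasis.eq_zero_of_mem_faceDirection_of_card_le_one hP1 hu
  -- As many minimizers as vertices already force `u = 0`, so the surplus ones are discarded while
  -- `i` is kept as base index.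
  obtain ⟨A', hiA', hA'A, hcard⟩ := Finset.exists_subsuperset_card_eq
    (Finset.singleton_subset_iff.2 hi) (by simpa using (not_le.1 hP1).le) hPA
  obtain ⟨p, hp⟩ : ∃ p, P.card = p + 1 := ⟨P.card - 1, by omega⟩
  obtain ⟨m₀, hm₀⟩ := Finset.card_pos.1 (show 0 < P.card by omega)
  obtain ⟨f, hf, hf0, hfA⟩ := Finset.exists_injective_enumeration
    (Finset.singleton_subset_iff.1 hiA') (hcard.trans hp)
  obtain ⟨j, hj, -, hjP⟩ := Finset.exists_injective_enumeration hm₀ hp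
  refine Subtype.ext (hy.eq_zero (by omega) hf hj ((σ.map_faceDirection hj hjP _).1 hu) fun a => ?_)
  have := hperp _ (hA'A ((hfA _).2 ⟨a.succ, rfl⟩))
  rw [σ.powerForm_sub_apply] at this
  rw [hf0]
  linarith

end Generic

/-! ### Mass of power cells on one simplex -/

section CellMeasure

open Filter Topology Set

variable {d N k : ℕ}

theorem isClosed_powerCell (y : Fin N → EuclideanSpace ℝ (Fin d)) (ψ : EuclideanSpace ℝ (Fin N))
    (i : Fin N) : IsClosed (powerCell y ψ i) := by
  have : powerCell y ψ i = ⋂ j, {x | ‖x - y i‖ ^ 2 + ψ i ≤ ‖x - y j‖ ^ 2 + ψ j} := by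
    ext; simp [powerCell]
  rw [this]
  exact isClosed_iInter fun j => isClosed_le (by fun_prop) (by fun_prop)

namespace Affine.Simplex

variable (σ : Affine.Simplex ℝ (EuclideanSpace ℝ (Fin d)) k)

/-- The measure with density `ρ` with respect to the volume of a simplex. -/
noncomputable def cellMeasure (ρ : EuclideanSpace ℝ (Fin d) → ℝ) :
    Measure (EuclideanSpace ℝ (Fin d)) :=
  ((Measure.euclideanHausdorffMeasure k).restrict (convexHull ℝ (range σ.points))).withDensity
    fun x => ENNReal.ofReal (ρ x)

theorem isCompact_convexHull_points : IsCompact (convexHull ℝ (range σ.points)) :=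
  (finite_range σ.points).isCompact_convexHull (𝕜 := ℝ)

variable {σ} {ρ : EuclideanSpace ℝ (Fin d) → ℝ}

theorem finrank_direction : Module.finrank ℝ (vectorSpan ℝ (range σ.points)) = k :=
  σ.independent.finrank_vectorSpan (n := k) (by simp)

/-- The chart is an isometry, so it carries the volume of the `k`-dimensional direction space to the
normalized Hausdorff measure on the affine span. -/
theorem cellMeasure_apply {B : Set (EuclideanSpace ℝ (Fin d))} (hB : MeasurableSet B) :
    σ.cellMeasure ρ B = ∫⁻ z in σ.chart ⁻¹' B ∩ convexHull ℝ (range σ.directionBasis),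
      ENNReal.ofReal (ρ (σ.chart z)) := by
  have hcell : MeasurableSet (convexHull ℝ (range σ.points)) :=
    σ.isCompact_convexHull_points.isClosed.measurableSet
  have hsub : B ∩ convexHull ℝ (range σ.points) ⊆ range σ.chart := by
    rw [← σ.chart_image_convexHull]
    exact inter_subset_right.trans (image_subset_range _ _)
  have hvol : (Measure.euclideanHausdorffMeasure k : Measure (vectorSpan ℝ (range σ.points))) =
      volume := by
    rw [← InnerProductSpace.euclideanHausdorffMeasure_eq_volume, finrank_direction]
  have hemb : MeasurableEmbedding σ.chart :=
    σ.isometry_chart.isClosedEmbedding.measurableEmbedding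
  rw [cellMeasure, withDensity_apply _ hB, Measure.restrict_restrict hB,
    ← Measure.restrict_restrict_of_subset hsub, ← σ.isometry_chart.map_euclideanHausdorffMeasure,
    hvol, hemb.restrict_map, hemb.lintegral_map, preimage_inter, σ.chart_preimage_convexHull]

theorem cellMeasure_eq_zero {B : Set (EuclideanSpace ℝ (Fin d))} (hB : MeasurableSet B)
    (h : volume (σ.chart ⁻¹' B) = 0) : σ.cellMeasure ρ B = 0 := by
  rw [cellMeasure_apply hB]
  exact setLIntegral_measure_zero _ _ (measure_mono_null inter_subset_left h)

theorem cellMeasure_finite_eq_zero (hk : 1 ≤ k) {B : Set (EuclideanSpace ℝ (Fin d))}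
    (hB : B.Finite) : σ.cellMeasure ρ B = 0 := by
  have : Nontrivial (vectorSpan ℝ (range σ.points)) :=
    Module.nontrivial_of_finrank_pos (R := ℝ) (by rw [finrank_direction]; omega)
  exact cellMeasure_eq_zero hB.measurableSet
    ((hB.preimage σ.isometry_chart.injective.injOn).measure_zero _)

theorem cellMeasure_inter {K B : Set (EuclideanSpace ℝ (Fin d))} (hB : MeasurableSet B)
    (hK : MeasurableSet K) (hsub : convexHull ℝ (range σ.points) ⊆ K) :
    σ.cellMeasure ρ (B ∩ K) = σ.cellMeasure ρ B := by
  rw [cellMeasure_apply (hB.inter hK), cellMeasure_apply hB, preimage_inter, inter_assoc,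
    inter_eq_self_of_subset_right (t := convexHull ℝ (range σ.directionBasis))]
  rw [← σ.chart_preimage_convexHull]
  exact preimage_mono hsub

theorem continuousOn_comp_chart (hρ : ContinuousOn ρ (convexHull ℝ (range σ.points))) :
    ContinuousOn (ρ ∘ σ.chart) (convexHull ℝ (range σ.directionBasis)) := by
  refine hρ.comp σ.isometry_chart.continuous.continuousOn ?_
  rw [← σ.chart_preimage_convexHull]
  exact mapsTo_preimage _ _

theorem isFiniteMeasure_cellMeasure (hρ : ContinuousOn ρ (convexHull ℝ (range σ.points))) :
    IsFiniteMeasure (σ.cellMeasure ρ) := by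
  refine ⟨?_⟩
  have hc : IsCompact (convexHull ℝ (range σ.directionBasis)) :=
    (finite_range σ.directionBasis).isCompact_convexHull (𝕜 := ℝ)
  rw [cellMeasure_apply MeasurableSet.univ, preimage_univ, univ_inter]
  exact ((continuousOn_comp_chart hρ).integrableOn_compact hc).lintegral_lt_top

theorem cellMeasure_real (hρ : ContinuousOn ρ (convexHull ℝ (range σ.points)))
    (hpos : ∀ x ∈ convexHull ℝ (range σ.points), 0 < ρ x)
    {B : Set (EuclideanSpace ℝ (Fin d))} (hB : MeasurableSet B) :
    (σ.cellMeasure ρ).real B =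
      ∫ z in σ.chart ⁻¹' B, (convexHull ℝ (range σ.directionBasis)).indicator (ρ ∘ σ.chart) z := by
  have hm : MeasurableSet (convexHull ℝ (range σ.directionBasis)) :=
    ((finite_range σ.directionBasis).isCompact_convexHull (𝕜 := ℝ)).isClosed.measurableSet
  have hBm : MeasurableSet (σ.chart ⁻¹' B) := σ.isometry_chart.continuous.measurable hB
  rw [setIntegral_indicator hm, integral_eq_lintegral_of_nonneg_ae, Measure.real,
    cellMeasure_apply hB]
  · rfl
  · filter_upwards [ae_restrict_mem (hBm.inter hm)] with z hz
    refine (hpos _ ?_).le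
    rw [← mem_preimage, σ.chart_preimage_convexHull]
    exact hz.2
  · exact ((continuousOn_comp_chart hρ).aestronglyMeasurable hm).mono_set inter_subset_right

/-- The constant part of `x ↦ ‖x - y i‖ ^ 2 - ‖x‖ ^ 2` in the chart of a simplex. -/
noncomputable def powerConst (σ : Affine.Simplex ℝ (EuclideanSpace ℝ (Fin d)) k)
    (y : Fin N → EuclideanSpace ℝ (Fin d)) (i : Fin N) : ℝ :=
  ‖y i‖ ^ 2 - 2 * inner ℝ (y i) (σ.points 0)

variable {y : Fin N → EuclideanSpace ℝ (Fin d)}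

/-- The quadratic term is independent of `i`, so comparing power distances amounts to comparing
affine functions. -/
theorem norm_chart_sub_sq (z : vectorSpan ℝ (range σ.points)) (i : Fin N) :
    ‖σ.chart z - y i‖ ^ 2 = ‖σ.chart z‖ ^ 2 + (σ.powerForm y i z + σ.powerConst y i) := by
  rw [norm_sub_sq_real, σ.powerForm_apply, powerConst, σ.chart_apply, real_inner_comm,
    inner_add_right]
  ring

theorem chart_mem_powerCell {z : vectorSpan ℝ (range σ.points)} {ψ : EuclideanSpace ℝ (Fin N)}
    {i : Fin N} : σ.chart z ∈ powerCell y ψ i ↔ ∀ j, σ.powerForm y i z + σ.powerConst y i + ψ i ≤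
      σ.powerForm y j z + σ.powerConst y j + ψ j := by
  change (∀ j, _) ↔ _
  refine forall_congr' fun j => ?_
  rw [norm_chart_sub_sq, norm_chart_sub_sq]
  constructor <;> intro h <;> linarith

theorem chart_preimage_powerCell (ψ : EuclideanSpace ℝ (Fin N)) (i : Fin N) :
    σ.chart ⁻¹' powerCell y ψ i = {z | ∀ j, σ.powerForm y i z + σ.powerConst y i + ψ i ≤
      σ.powerForm y j z + σ.powerConst y j + ψ j} := by
  ext z
  exact chart_mem_powerCell

theorem powerForm_sub_ne_zero (hk : 1 ≤ k) (hy : SimplexSoup.IsGenericForSimplex y σ) {i j : Fin N}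
    (hij : j ≠ i) : ∃ w, (σ.powerForm y i - σ.powerForm y j) w ≠ 0 := by
  obtain ⟨u, -, hu⟩ := hy.powerForm_surjective Finset.univ {j, i} j (by simp)
    (by rw [Finset.card_pair hij]) (by rw [Finset.card_pair hij]; simp; omega) fun _ => 1
  exact ⟨u, by rw [hu i (by simp) hij.symm]; exact one_ne_zero⟩

theorem cellMeasure_powerCell_inter (hk : 1 ≤ k) (hy : SimplexSoup.IsGenericForSimplex y σ)
    (ψ : EuclideanSpace ℝ (Fin N)) {i j : Fin N} (hij : j ≠ i) :
    σ.cellMeasure ρ (powerCell y ψ i ∩ powerCell y ψ j) = 0 := by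
  refine cellMeasure_eq_zero
    ((isClosed_powerCell _ _ _).inter (isClosed_powerCell _ _ _)).measurableSet ?_
  obtain ⟨w, hw⟩ := powerForm_sub_ne_zero hk hy hij
  have h := ae_add_ne_of_linear_ne_zero volume
    (σ.powerForm y i - σ.powerForm y j : _ →L[ℝ] ℝ).toLinearMap (w := w) hw 0
    (σ.powerConst y j + ψ j - (σ.powerConst y i + ψ i))
  refine measure_mono_null (fun z hz => ?_) (ae_iff.1 h)
  have h1 := chart_mem_powerCell.1 hz.1 j
  have h2 := chart_mem_powerCell.1 hz.2 i
  change ¬ (0 + (σ.powerForm y i z - σ.powerForm y j z) ≠ _)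
  rw [not_not]
  linarith

/-- Differentiability of the mass of a power cell restricted to a simplex; the derivative with
respect to the weight of a neighbor is positive as soon as the interface contains a nonisolated
point of the simplex. -/
theorem exists_hasFDerivAt_cellMeasure_powerCell (hk : 2 ≤ k)
    (hy : SimplexSoup.IsGenericForSimplex y σ)
    (hρ : ContinuousOn ρ (convexHull ℝ (range σ.points)))
    (hpos : ∀ x ∈ convexHull ℝ (range σ.points), 0 < ρ x) (ψ : EuclideanSpace ℝ (Fin N)) :
    ∃ S : Set (EuclideanSpace ℝ (Fin d)), S.Finite ∧ ∀ i, ∃ H : Fin N → ℝ, (∀ j, 0 ≤ H j) ∧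
      HasFDerivAt (fun ψ => (σ.cellMeasure ρ).real (powerCell y ψ i))
        (∑ j, H j • (EuclideanSpace.proj j - EuclideanSpace.proj i :
          EuclideanSpace ℝ (Fin N) →L[ℝ] ℝ)) ψ ∧
      ∀ j, j ≠ i → ∀ x ∈ convexHull ℝ (range σ.points), x ∉ S → x ∈ powerCell y ψ i →
        x ∈ powerCell y ψ j → 0 < H j := by
  have hsurj := hy.powerForm_surjective
  refine ⟨σ.chart '' isolatedPoints σ.directionBasis (σ.powerForm y)
    (fun i => σ.powerConst y i + ψ i), (finite_isolatedPoints _ _ _).image _, fun i => ?_⟩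
  obtain ⟨H, hH0, hH, hHpos⟩ := exists_hasFDerivAt_setIntegral_affineCell volume σ.directionBasis
    (continuousOn_comp_chart hρ)
    (fun z hz => hpos _ (by rwa [← mem_preimage, σ.chart_preimage_convexHull]))
    (σ.powerForm y) (σ.powerConst y) i
    (fun j hj => powerForm_sub_ne_zero (by omega) hy hj)
    (fun j l hj hl hlj => by
      -- Three sites against all `k + 1` vertices: this is where `2 ≤ k` enters.
      obtain ⟨u, -, hu⟩ := hsurj Finset.univ {i, j, l} i (by simp)
        (by rw [Finset.card_eq_three.2 ⟨i, j, l, hj.symm, hl.symm, hlj.symm, rfl⟩]; omega)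
        (by
          rw [Finset.card_eq_three.2 ⟨i, j, l, hj.symm, hl.symm, hlj.symm, rfl⟩,
            Finset.card_univ, Fintype.card_fin]
          omega)
        fun m => if m = j then 0 else 1
      have h1 := hu j (by simp) hj
      have h2 := hu l (by simp) hl
      simp only [if_true, if_neg hlj, _root_.sub_apply] at h1 h2 ⊢
      exact ⟨u, by linarith, by intro h; linarith⟩)
    (fun j hj m => by
      -- The facet opposite `m` has `k ≥ 2` vertices, so some `u` tangent to it satisfies `(g i - g
      -- j) u = 1`. Subtracting a multiple of `u` from an edge vector ending at vertex `m` kills `g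
      -- i - g j` without changing the `m`-component.
      obtain ⟨u, hum, hu⟩ := hsurj (Finset.univ.erase m) {j, i} j (by simp)
        (by rw [Finset.card_pair hj])
        (by
          rw [Finset.card_pair hj, Finset.card_erase_of_mem (Finset.mem_univ m), Finset.card_univ,
            Fintype.card_fin]
          omega) fun _ => 1
      have h1 := hu i (by simp) hj.symm
      have : Nontrivial (Fin (k + 1)) := Fin.nontrivial_iff_two_le.2 (by omega)
      obtain ⟨m', hm'⟩ := exists_ne m
      set w := σ.directionBasis m - σ.directionBasis m' with hw
      refine ⟨w - (σ.powerForm y i - σ.powerForm y j) w • u, ?_, ?_⟩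
      · rw [map_sub, map_smul, h1]
        simp
      · rw [map_sub, map_smul, AffineBasis.mem_faceDirection.1 hum m (by simp), hw,
          AffineBasis.linear_coord_sub, AffineBasis.coord_apply_eq,
          AffineBasis.coord_apply_ne _ hm'.symm]
        simp)
    ψ
  refine ⟨H, hH0, ?_, fun j hj x hx hxS hxi hxj => ?_⟩
  · have : (fun ψ => (σ.cellMeasure ρ).real (powerCell y ψ i)) = fun ψ =>
        ∫ z in {z | ∀ j, σ.powerForm y i z + σ.powerConst y i + ψ i ≤
          σ.powerForm y j z + σ.powerConst y j + ψ j},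
        (convexHull ℝ (range σ.directionBasis)).indicator (ρ ∘ σ.chart) z := by
      ext ψ
      rw [cellMeasure_real hρ hpos (isClosed_powerCell _ _ _).measurableSet,
        chart_preimage_powerCell]
    rw [this]
    exact hH
  · rw [← σ.chart_image_convexHull] at hx
    obtain ⟨z, hz, rfl⟩ := hx
    have hxi := chart_mem_powerCell.1 hxi
    have hxj := chart_mem_powerCell.1 hxj
    simp only [add_assoc] at hxi hxj
    obtain ⟨q, hq, hqe, hql⟩ := exists_interior_point_two_minimizers σ.directionBasis
      (σ.powerForm y) hsurj
      (fun P A i hi _ hPA u hu hperp => hy.powerForm_injective P A i hi hPA u hu hperp)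
      (fun i => σ.powerConst y i + ψ i) hz (fun h => hxS (mem_image_of_mem _ h)) hj hxi hxj
    simp only [← add_assoc] at hqe hql
    exact hHpos j hj ⟨q, hq, hqe, hql⟩

end Affine.Simplex

end CellMeasure

/-! ### Assembly of the differential of the mass map -/

section MassMap

open Filter Topology Set

variable {d N : ℕ}

/-- Expanding the square and applying `hcol` to `v ^ 2` removes the pure squares; this replaces the
usual symmetry of `H`. -/
theorem two_mul_sum_mul_sub_eq {ι : Type*} [Fintype ι] (H : ι → ι → ℝ)
    (hcol : ∀ w : ι → ℝ, ∑ i, ∑ j, H i j * (w j - w i) = 0) (v : ι → ℝ) :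
    2 * ∑ i, v i * ∑ j, H i j * (v j - v i) = -∑ i, ∑ j, H i j * (v i - v j) ^ 2 := by
  have h := hcol fun i => v i ^ 2
  have : ∀ i j, H i j * (v i - v j) ^ 2 =
      H i j * (v j ^ 2 - v i ^ 2) - 2 * (v i * (H i j * (v j - v i))) := fun i j => by ring
  simp_rw [this, Finset.sum_sub_distrib, h, Finset.mul_sum]
  simp

theorem SimplexSoup.isCompact_support (T : SimplexSoup d) : IsCompact T.support :=
  isCompact_iUnion fun s => (T.simplex s).2.isCompact_convexHull_points

theorem SimplexSoup.simplicialMeasure_eq (T : SimplexSoup d)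
    (ρ : Fin T.card → EuclideanSpace ℝ (Fin d) → ℝ) :
    T.simplicialMeasure ρ = ∑ s, (T.simplex s).2.cellMeasure (ρ s) := rfl

theorem SimplexSoup.simplicialMeasure_apply (T : SimplexSoup d)
    (ρ : Fin T.card → EuclideanSpace ℝ (Fin d) → ℝ) (B : Set (EuclideanSpace ℝ (Fin d))) :
    T.simplicialMeasure ρ B = ∑ s, (T.simplex s).2.cellMeasure (ρ s) B := by
  rw [T.simplicialMeasure_eq, Measure.finsetSum_apply]

theorem exists_mem_powerCell [Nonempty (Fin N)] (y : Fin N → EuclideanSpace ℝ (Fin d))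
    (ψ : EuclideanSpace ℝ (Fin N)) (x : EuclideanSpace ℝ (Fin d)) : ∃ i, x ∈ powerCell y ψ i := by
  obtain ⟨i, hi⟩ := Finite.exists_min fun i => ‖x - y i‖ ^ 2 + ψ i
  exact ⟨i, hi⟩

theorem massMap_apply (T : SimplexSoup d) (μ : Measure (EuclideanSpace ℝ (Fin d)))
    (y : Fin N → EuclideanSpace ℝ (Fin d)) (ψ : EuclideanSpace ℝ (Fin N)) (i : Fin N) :
    massMap T μ y ψ i = μ.real (laguerreCell T y ψ i) := rfl

/-- If the support stays connected when `S` is removed, the interface between two complementary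
families of Laguerre cells contains a point outside `S`. -/
theorem exists_mem_interface [Nonempty (Fin N)] (T : SimplexSoup d)
    (y : Fin N → EuclideanSpace ℝ (Fin d)) (ψ : EuclideanSpace ℝ (Fin N))
    {S : Set (EuclideanSpace ℝ (Fin d))} (hconn : IsConnected (T.support \ S))
    (hne : ∀ i, (laguerreCell T y ψ i \ S).Nonempty) (I : Set (Fin N)) (hI : I.Nonempty)
    (hI' : Iᶜ.Nonempty) :
    ∃ i ∈ I, ∃ j ∉ I, ∃ x ∈ T.support, x ∉ S ∧ x ∈ powerCell y ψ i ∧ x ∈ powerCell y ψ j := by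
  have hclosed : ∀ J : Set (Fin N), IsClosed (⋃ i ∈ J, powerCell y ψ i) := fun J =>
    J.toFinite.isClosed_biUnion fun i _ => isClosed_powerCell y ψ i
  have hmeet : ∀ J : Set (Fin N), J.Nonempty →
      ((T.support \ S) ∩ ⋃ i ∈ J, powerCell y ψ i).Nonempty := by
    rintro J ⟨i, hi⟩
    obtain ⟨x, hx, hxS⟩ := hne i
    exact ⟨x, ⟨hx.2, hxS⟩, mem_biUnion hi hx.1⟩
  obtain ⟨x, ⟨hxK, hxS⟩, hx1, hx2⟩ := isPreconnected_closed_iff.1 hconn.isPreconnected _ _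
    (hclosed I) (hclosed Iᶜ)
    (fun x _ => by
      obtain ⟨i, hi⟩ := exists_mem_powerCell y ψ x
      by_cases hiI : i ∈ I
      · exact Or.inl (mem_biUnion hiI hi)
      · exact Or.inr (mem_biUnion (show i ∈ Iᶜ from hiI) hi))
    (hmeet I hI) (hmeet Iᶜ hI')
  obtain ⟨i, hi, hxi⟩ := mem_iUnion₂.1 hx1
  obtain ⟨j, hj, hxj⟩ := mem_iUnion₂.1 hx2
  exact ⟨i, hi, j, hj, x, hxK, hxS, hxi, hxj⟩

/-- The total mass of the Laguerre cells does not depend on the weights. -/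
theorem sum_real_laguerreCell [Nonempty (Fin N)] (T : SimplexSoup d)
    (μ : Measure (EuclideanSpace ℝ (Fin d))) [IsFiniteMeasure μ]
    (y : Fin N → EuclideanSpace ℝ (Fin d)) (ψ : EuclideanSpace ℝ (Fin N))
    (hnull : ∀ i j, j ≠ i → μ (powerCell y ψ i ∩ powerCell y ψ j) = 0) :
    ∑ i, μ.real (laguerreCell T y ψ i) = μ.real T.support := by
  have hK := T.isCompact_support.isClosed
  have hunion : T.support = ⋃ i, laguerreCell T y ψ i := by
    ext x
    simp only [laguerreCell, mem_iUnion, mem_inter_iff, exists_and_right]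
    exact ⟨fun h => ⟨exists_mem_powerCell y ψ x, h⟩, fun h => h.2⟩
  rw [hunion, Measure.real, measure_iUnion₀, tsum_fintype, ENNReal.toReal_sum]
  · rfl
  · exact fun i _ => measure_ne_top _ _
  · intro i j hij
    exact measure_mono_null (inter_subset_inter inter_subset_left inter_subset_left)
      (hnull i j hij.symm)
  · exact fun i => ((isClosed_powerCell y ψ i).inter hK).measurableSet.nullMeasurableSet

/-- Differentiability of the mass map, together with a description of its differential. -/
theorem exists_hasFDerivAt_massMap [Nonempty (Fin N)] (T : SimplexSoup d)
    (ρ : Fin T.card → EuclideanSpace ℝ (Fin d) → ℝ)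
    (hρ : ∀ s, ContinuousOn (ρ s) (T.cell s)) (hpos : ∀ s, ∀ x ∈ T.cell s, 0 < ρ s x)
    (hdim : ∀ s, 2 ≤ T.dim s) (y : Fin N → EuclideanSpace ℝ (Fin d)) (hy : T.IsGeneric y)
    (ψ : EuclideanSpace ℝ (Fin N)) :
    ∃ S : Set (EuclideanSpace ℝ (Fin d)), S.Finite ∧ ∃ H : Fin N → Fin N → ℝ, (∀ i j, 0 ≤ H i j) ∧
      (∀ i, HasFDerivAt (fun ψ => massMap T (T.simplicialMeasure ρ) y ψ i)
        (∑ j, H i j • (EuclideanSpace.proj j - EuclideanSpace.proj i :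
          EuclideanSpace ℝ (Fin N) →L[ℝ] ℝ)) ψ) ∧
      (∀ w : Fin N → ℝ, ∑ i, ∑ j, H i j * (w j - w i) = 0) ∧
      ∀ i j, j ≠ i → ∀ x ∈ T.support, x ∉ S → x ∈ powerCell y ψ i →
        x ∈ powerCell y ψ j → 0 < H i j := by
  have hfin : ∀ s, IsFiniteMeasure ((T.simplex s).2.cellMeasure (ρ s)) :=
    fun s => Affine.Simplex.isFiniteMeasure_cellMeasure (hρ s)
  have hfinμ : IsFiniteMeasure (T.simplicialMeasure ρ) := by
    refine ⟨?_⟩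
    rw [T.simplicialMeasure_apply]
    exact ENNReal.sum_lt_top.2 fun s _ => measure_lt_top _ _
  choose S hS H hH0 hH hHpos using fun s =>
    Affine.Simplex.exists_hasFDerivAt_cellMeasure_powerCell (hdim s) (hy s) (hρ s) (hpos s) ψ
  have hreal : ∀ (ψ : EuclideanSpace ℝ (Fin N)) i, massMap T (T.simplicialMeasure ρ) y ψ i =
      ∑ s, ((T.simplex s).2.cellMeasure (ρ s)).real (powerCell y ψ i) := by
    intro ψ i
    rw [massMap_apply, Measure.real, T.simplicialMeasure_apply,
      ENNReal.toReal_sum fun s _ => measure_ne_top _ _]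
    refine Finset.sum_congr rfl fun s _ => ?_
    rw [laguerreCell, Affine.Simplex.cellMeasure_inter (isClosed_powerCell y ψ i).measurableSet
      T.isCompact_support.isClosed.measurableSet (subset_iUnion T.cell s)]
    rfl
  have hder : ∀ i, HasFDerivAt (fun ψ => massMap T (T.simplicialMeasure ρ) y ψ i)
      (∑ j, (∑ s, H s i j) • (EuclideanSpace.proj j - EuclideanSpace.proj i :
        EuclideanSpace ℝ (Fin N) →L[ℝ] ℝ)) ψ := by
    intro i
    simp_rw [hreal]
    refine (HasFDerivAt.fun_sum fun s _ => hH s i).congr_fderiv ?_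
    rw [Finset.sum_comm]
    simp_rw [Finset.sum_smul]
  refine ⟨⋃ s, S s, finite_iUnion hS, fun i j => ∑ s, H s i j,
    fun i j => Finset.sum_nonneg fun s _ => hH0 s i j, hder, fun w => ?_, ?_⟩
  -- Differentiating the conserved total mass in the direction `w` gives the identity.
  · have hconst : (fun ψ => ∑ i, massMap T (T.simplicialMeasure ρ) y ψ i) =
        fun _ => (T.simplicialMeasure ρ).real T.support := by
      ext ψ
      refine sum_real_laguerreCell T _ y ψ fun i j hij => ?_
      rw [T.simplicialMeasure_apply]
      exact Finset.sum_eq_zero fun s _ => Affine.Simplex.cellMeasure_powerCell_inter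
        (by have := hdim s; rw [SimplexSoup.dim] at this; omega) (hy s) ψ hij
    have h1 := HasFDerivAt.fun_sum (u := Finset.univ) fun i _ => hder i
    rw [hconst] at h1
    have h2 := h1.unique (hasFDerivAt_const _ _)
    have h3 := congrArg (fun L : EuclideanSpace ℝ (Fin N) →L[ℝ] ℝ => L (WithLp.toLp 2 w)) h2
    simpa [_root_.sum_apply] using h3
  · intro i j hij x hx hxS hxi hxj
    obtain ⟨s, hs⟩ := mem_iUnion.1 hx
    exact Finset.sum_pos' (fun s _ => hH0 s i j) ⟨s, Finset.mem_univ s,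
      hHpos s i j hij x hs (fun h => hxS (mem_iUnion_of_mem s h)) hxi hxj⟩

end MassMap

/-! ### Negativity of the quadratic form -/

/-- Strict monotonicity of `G` on the zero-sum hyperplane. Differentiability is part of the
conclusion, so that `fderiv` is the genuine differential. -/
theorem mainTheorem3 {d N : ℕ} (T : SimplexSoup d)
    (μ : MeasureTheory.Measure (EuclideanSpace ℝ (Fin d)))
    (hμ : T.IsRegularSimplicialMeasure μ)
    (y : Fin N → EuclideanSpace ℝ (Fin d)) (hy : T.IsGeneric y)
    (ψ : EuclideanSpace ℝ (Fin N)) (hψ : ψ ∈ positiveMassSet T μ y) :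
    DifferentiableAt ℝ (massMap T μ y) ψ ∧
      ∀ v : EuclideanSpace ℝ (Fin N), v ≠ 0 → ∑ i, v i = 0 →
        inner ℝ (fderiv ℝ (massMap T μ y) ψ v) v < 0 := by
  obtain ⟨⟨ρ, rfl, hρ⟩, hdim, hconn⟩ := hμ
  rcases isEmpty_or_nonempty (Fin N) with hN | hN
  · exact ⟨(hasFDerivAt_of_subsingleton _ _).differentiableAt, fun v hv => absurd (Subsingleton.elim v 0) hv⟩
  obtain ⟨S, hS, H, hH0, hH, hcol, hHpos⟩ := exists_hasFDerivAt_massMap T ρ (fun s => (hρ s).1)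
    (fun s => (hρ s).2) hdim y hy ψ
  have hdiff : DifferentiableAt ℝ (massMap T (T.simplicialMeasure ρ) y) ψ :=
    differentiableAt_euclidean.2 fun i => (hH i).differentiableAt
  refine ⟨hdiff, fun v hv hsum => ?_⟩
  have happly : ∀ i, fderiv ℝ (massMap T (T.simplicialMeasure ρ) y) ψ v i =
      ∑ j, H i j * (v j - v i) := by
    intro i
    have h := ((EuclideanSpace.proj i :
      EuclideanSpace ℝ (Fin N) →L[ℝ] ℝ).hasFDerivAt.comp ψ hdiff.hasFDerivAt).unique (hH i)
    have h' := congrArg (fun L : EuclideanSpace ℝ (Fin N) →L[ℝ] ℝ => L v) h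
    simpa [_root_.sum_apply] using h'
  have hinner : inner ℝ (fderiv ℝ (massMap T (T.simplicialMeasure ρ) y) ψ v) v =
      ∑ i, v i * ∑ j, H i j * (v j - v i) := by
    rw [PiLp.inner_apply]
    refine Finset.sum_congr rfl fun i _ => ?_
    rw [happly]
    rfl
  obtain ⟨i₀, hi₀⟩ := Finite.exists_max fun i => v i
  have hlt : ∃ j, v j < v i₀ := by
    by_contra! hcon
    have hconst : ∀ j, v j = v i₀ := fun j => le_antisymm (hi₀ j) (hcon j)
    have h0 : (Fintype.card (Fin N) : ℝ) * v i₀ = 0 := by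
      rw [← hsum, Finset.sum_congr rfl fun j _ => hconst j]
      simp
    have hi0 : v i₀ = 0 :=
      (mul_eq_zero.1 h0).resolve_left (Nat.cast_ne_zero.2 Fintype.card_ne_zero)
    exact hv (by ext j; simp [hconst j, hi0])
  obtain ⟨j₀, hj₀⟩ := hlt
  have hSsub := hconn (T.support ∩ S) Set.inter_subset_left (hS.subset Set.inter_subset_right)
  rw [Set.sdiff_self_inter] at hSsub
  -- The family `I` consists of the indices where `v` is maximal. No cell lies inside `S`, because
  -- the cells have positive mass and finite sets are null.
  obtain ⟨i, hi, j, hj, x, hxK, hxS, hxi, hxj⟩ := exists_mem_interface T y ψ hSsub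
    (fun i => by
      by_contra hemp
      have hsub : laguerreCell T y ψ i ⊆ S := by
        rwa [Set.not_nonempty_iff_eq_empty, Set.sdiff_eq_empty] at hemp
      have hnull : T.simplicialMeasure ρ S = 0 := by
        rw [T.simplicialMeasure_apply]
        exact Finset.sum_eq_zero fun s _ => Affine.Simplex.cellMeasure_finite_eq_zero
          (by have := hdim s; rw [SimplexSoup.dim] at this; omega) hS
      have hi := hψ i
      rw [massMap_apply, MeasureTheory.Measure.real,
        MeasureTheory.measure_mono_null hsub hnull] at hi
      simp at hi)
    {i | v i = v i₀} ⟨i₀, rfl⟩ ⟨j₀, hj₀.ne⟩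
  have hij : v i ≠ v j := fun h => hj (h.symm.trans hi)
  have hquad := two_mul_sum_mul_sub_eq H hcol v
  have hpos : 0 < ∑ i, ∑ j, H i j * (v i - v j) ^ 2 := by
    have hnn : ∀ i j, 0 ≤ H i j * (v i - v j) ^ 2 := fun i j =>
      mul_nonneg (hH0 i j) (sq_nonneg _)
    refine Finset.sum_pos' (fun i _ => Finset.sum_nonneg fun j _ => hnn i j)
      ⟨i, Finset.mem_univ i, Finset.sum_pos' (fun j _ => hnn i j) ⟨j, Finset.mem_univ j, ?_⟩⟩
    exact mul_pos (hHpos i j (fun h => hij (by rw [h])) x hxK hxS hxi hxj)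
      (sq_pos_of_ne_zero (sub_ne_zero.2 hij))
  rw [hinner]
  linarith
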